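/- **Graphs.** A *graph* $G$ is a diagram of finite sets $A\xleftarrow{s}D\xrightarrow{t}V$ with a fixed-point-free involution $i$ on the set $A$ of *arcs*, $s$ injective (regard $D\subseteq A$), and a subset $\partial G\subseteq A\setminus D$, the *boundary*, such that $iD\setminus D\subseteq\partial G$ and $\partial G\setminus iD$ is $i$-closed. $V$ is the set of *vertices*, $\mathrm{nb}(v)=t^{-1}(v)$. $G$ is *safe* if $\partial G=A\setminus D$, and *connected* if the diagram is non-empty and not a coproduct of two non-empty diagrams. An *isomorphism* is an isomorphism of diagrams preserving $i$ and the boundary. The *edge* has $A=\partial=\{a,ia\}$, $D=V=\varnothing$. The *star* $\star_S$ on a finite set $S$ has one vertex, $A=S\amalg S^\dagger$ with $i$ exchanging $s$ and $s^\dagger$, $D=S^\dagger$, $\partial=S$. Given graphs $H_v$ for $v\in V(G)$ and bijections $m_v:i\,\mathrm{nb}(v)\to\partial H_v$, the *graph substitution* $G\{H_v\}$ is obtained by replacing each vertex $v$ by $H_v$: its arcs are those of $G$ and of the $H_v$, modulo the involution-compatible equivalence relation generated by $a\sim m_v(a)$ for $a\in i\,\mathrm{nb}(v)$; its $D$ and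 $V$ are $\coprod_v D(H_v)$ and $\coprod_v V(H_v)$; its boundary is the image of $\partial G$. **The category $\mathbf U$.** A map of diagrams $G\to G'$ compatible with the involutions is *étale* if the square $D\to V$ over $D'\to V'$ is a pullback and $A\setminus(\partial G\cup D)$ is sent into $A'\setminus(\partial G'\cup D')$; an *embedding* is an étale map between connected graphs that is injective on vertices. $\mathrm{Emb}(G)$ is the set of embeddings with codomain $G$ modulo $f\sim fz$ for isomorphisms $z$. For $f:K\hookrightarrow G$ put $\varsigma(f)=\sum_{u\in V(K)}f(u)\in\mathbb N V(G)$ and $\partial(f)=f(\partial K)\subseteq A(G)$; these depend only on the class of $f$, and $f|_{\partial K}$ is injective. The objects of the *graphical category* $\mathbf U$ are the safe connected graphs. A *graphical map* $\varphi:G\to G'$ consists of an involutive map $\varphi_0:A\to A'$ and a function $\varphi_1:V\to\mathrm{Emb}(G')$ such that (i) $\sum_{v\in V}\varsigma(\varphi_1(v))\le\sum_{w\in V'}w$ in $\mathbb N V'$; (ii) for each $v\in V$, $\varphi_0\circ i$ restricts to a bijection $\mathrm{nb}(v)\to\partial(\varphi_1(v))$; (iii) if $\partial G=\varnothing$, then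 for some $v$ the domain of $\varphi_1(v)$ is not an edge. For $\psi:G'\to G''$, $(\psi\varphi)_0=\psi_0\varphi_0$, and $(\psi\varphi)_1(v)$ is the class of the embedding $K\{H_w\}\hookrightarrow G''$ assembled from representatives $H_w\hookrightarrow G''$ of the $\psi_1(w)$, where $K\hookrightarrow G'$ represents $\varphi_1(v)$ and $w$ runs over the vertices of $K$. The identity of $G$ is the identity on arcs and sends $v$ to the class of the canonical embedding $\star_{i\,\mathrm{nb}(v)}\hookrightarrow G$. **The category $\mathbf{CSM}$.** Let $C$ be a set with an involution. $\mathrm{Bij}_C$ is the groupoid of finite sets $S$ with a map $\xi:S\to C$ and of bijections over $C$. A $C$-coloured graph is a connected graph $K$ with an involutive map $\zeta:A(K)\to C$. For $X:\mathrm{Bij}_C\to\mathbf{Set}$ let $$(T_CX)(S,\xi)=\operatorname{colim}_{(f,K,\zeta)}\ \prod_{v\in V(K)}X\big(i\,\mathrm{nb}(v),\zeta|_{i\,\mathrm{nb}(v)}\big),$$ the colimit being over the groupoid of $C$-coloured graphs $(K,\zeta)$ (nodeless loops, i.e. two-arc graphs with $D=V=\partial=\varnothing$, are included) equipped with a bijection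 $f:S\to\partial K$ with $\zeta f=\xi$. Graph substitution and the stars make $T_C$ a monad, the *free graph monad*. A *modular operad* with colours $C$ is a $T_C$-algebra in $\mathbf{Set}^{\mathrm{Bij}_C}$; $F_C$ is the free algebra functor. For an involutive map $f:C\to C'$ and a $T_{C'}$-algebra $Q$, $f^*Q$ is the $T_C$-algebra with $(f^*Q)(S,\xi)=Q(S,f\xi)$. $\mathbf{CSM}$ is the category of pairs of an involutive set $C$ and a $T_C$-algebra; a morphism $(C,P)\to(C',Q)$ is a pair of an involutive map $f:C\to C'$ and a morphism of $T_C$-algebras $P\to f^*Q$. **The assignment $J$.** For a connected graph $G$ with arcs $A$ let $\underline G:\mathrm{Bij}_A\to\mathbf{Set}$ be such that $\underline G(S,\xi)$ is the set of vertices $v$ for which $\xi$ is injective with image $i\,\mathrm{nb}(v)$, and let $\langle G\rangle=(A,F_A(\underline G))$, the free $A$-coloured modular operad generated by the vertices of $G$. Put $J(G)=\langle G\rangle$. For a graphical map $\varphi:G\to G'$ let $J(\varphi):\langle G\rangle\to\langle G'\rangle$ be the morphism that is $\varphi_0$ on colours and sends the generator $v\in\underline G(i\,\mathrm{nb}(v),\mathrm{incl})$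 to the element of $\langle G'\rangle(i\,\mathrm{nb}(v),\varphi_0|_{i\,\mathrm{nb}(v)})$ represented by the domain $K$ of an embedding $r:K\hookrightarrow G'$ of class $\varphi_1(v)$, with arcs coloured by $r:A(K)\to A'$, each vertex $u$ decorated by $r(u)$, and $i\,\mathrm{nb}(v)$ identified with $\partial K$ by (ii); this element does not depend on the choice of $r$. **Proposition.** These assignments constitute a functor $J:\mathbf U\to\mathbf{CSM}$, that is, $J(\mathrm{id}_G)=\mathrm{id}$ and $J(\psi\varphi)=J(\psi)J(\varphi)$ for all composable graphical maps. This functor is faithful, and it is injective on isomorphism classes of objects: if $J(G)\cong J(G')$ in $\mathbf{CSM}$, then $G\cong G'$ in $\mathbf U$. Moreover, every isomorphism $J(G)\to J(G')$ in $\mathbf{CSM}$ is equal to $J(\varphi)$ for an isomorphism $\varphi:G\to G'$ in $\mathbf U$. -/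

import Mathlib

open CategoryTheory

namespace ModOp

/-! ## Graphs -/

/-- A (possibly disconnected, possibly unsafe) graph with loose ends: a diagram of finite sets
`A ← D → V` with a free involution `i` on the set `A` of arcs, `s` injective, and a specified
boundary `bd`, a set of arcs disjoint from the image of `s`. -/
structure MGraph where
  A : Type
  D : Type
  V : Type
  finA : Finite A
  finD : Finite D
  finV : Finite V
  i : A → A
  s : D → A
  t : D → V
  bd : Set A
  bd_sub : bd ⊆ (Set.range s)ᶜ
  i_i : ∀ a, i (i a) = a
  i_ne : ∀ a, i a ≠ a
  s_inj : Function.Injective s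
  sub_bd : (i '' Set.range s) \ Set.range s ⊆ bd
  bd_closed : ∀ a ∈ bd \ (i '' Set.range s), i a ∈ bd \ (i '' Set.range s)

namespace MGraph

attribute [instance] MGraph.finA MGraph.finD MGraph.finV

/-- A graph is safe when its boundary is as large as possible. -/
def Safe (G : MGraph) : Prop := G.bd = (Set.range G.s)ᶜ

/-- Connectedness of the diagram `A ← D → V`: it is non-empty, and in every decomposition of it
into two complementary subdiagrams one of the two is empty. -/
def Connected (G : MGraph) : Prop :=
  (Nonempty G.A ∨ Nonempty G.V) ∧
    ∀ (P : G.A → Prop) (Q : G.V → Prop), (∀ a, P (G.i a) ↔ P a) →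
      (∀ d, P (G.s d) ↔ Q (G.t d)) →
        ((∀ a, P a) ∧ (∀ v, Q v)) ∨ ((∀ a, ¬ P a) ∧ (∀ v, ¬ Q v))

/-- The neighborhood of a vertex. -/
abbrev N (G : MGraph) (v : G.V) : Type := {d : G.D // G.t d = v}

/-- The exceptional edge. -/
def edge : MGraph where
  A := Bool
  D := Empty
  V := Empty
  finA := inferInstance
  finD := inferInstance
  finV := inferInstance
  i := not
  s := Empty.elim
  t := Empty.elim
  bd := Set.univ
  bd_sub := by rintro _ _ ⟨⟨⟩, _⟩
  i_i := by simp
  i_ne := by simp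
  s_inj := by rintro ⟨⟩
  sub_bd := fun _ _ => trivial
  bd_closed := by rintro a -; exact ⟨trivial, by rintro ⟨_, ⟨⟨⟩, _⟩, _⟩⟩

/-- The star on a finite set `S`: one vertex, arcs `S ⊕ S` (the left summand is `S`, the right
summand is its copy `S†`), neighborhood `S†` and boundary `S`. -/
def star (S : Type) [Finite S] : MGraph where
  A := S ⊕ S
  D := S
  V := Unit
  finA := inferInstance
  finD := inferInstance
  finV := inferInstance
  i := Sum.swap
  s := Sum.inr
  t := fun _ => ()
  bd := Set.range Sum.inl
  bd_sub := by rintro _ ⟨x, rfl⟩ ⟨y, hy⟩; cases hy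
  i_i := Sum.swap_swap
  i_ne := by rintro (a | a) h <;> cases h
  s_inj := Sum.inr_injective
  sub_bd := by rintro _ ⟨⟨_, ⟨x, rfl⟩, rfl⟩, _⟩; exact ⟨x, rfl⟩
  bd_closed := by
    rintro _ ⟨⟨x, rfl⟩, h⟩
    exact absurd ⟨_, ⟨x, rfl⟩, rfl⟩ h

theorem star_connected (S : Type) [Finite S] : (star S).Connected := by
  refine ⟨Or.inr ⟨()⟩, fun P Q hi hs => ?_⟩
  by_cases h : Q ()
  · refine Or.inl ⟨?_, fun _ => h⟩
    rintro (a | a)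
    · exact (hi (Sum.inr a)).2 ((hs a).2 h)
    · exact (hs a).2 h
  · refine Or.inr ⟨?_, fun _ => h⟩
    rintro (a | a) h'
    · exact h ((hs a).1 ((hi (Sum.inl a)).2 h'))
    · exact h ((hs a).1 h')

/-- Isomorphisms of graphs. -/
structure Iso (G H : MGraph) where
  a : G.A ≃ H.A
  d : G.D ≃ H.D
  v : G.V ≃ H.V
  a_i : ∀ x, a (G.i x) = H.i (a x)
  a_s : ∀ x, a (G.s x) = H.s (d x)
  v_t : ∀ x, v (G.t x) = H.t (d x)
  a_bd : ∀ x, a x ∈ H.bd ↔ x ∈ G.bd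

namespace Iso

@[simps] def refl (G : MGraph) : Iso G G :=
  ⟨Equiv.refl _, Equiv.refl _, Equiv.refl _, fun _ => rfl, fun _ => rfl, fun _ => rfl,
    fun _ => Iff.rfl⟩

@[simps] def trans {G H K : MGraph} (z : Iso G H) (w : Iso H K) : Iso G K :=
  ⟨z.a.trans w.a, z.d.trans w.d, z.v.trans w.v, fun x => by simp [z.a_i, w.a_i],
    fun x => by simp [z.a_s, w.a_s], fun x => by simp [z.v_t, w.v_t],
    fun x => by simp [z.a_bd, w.a_bd]⟩

@[simps] def symm {G H : MGraph} (z : Iso G H) : Iso H G :=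
  ⟨z.a.symm, z.d.symm, z.v.symm,
    fun x => by rw [Equiv.symm_apply_eq, z.a_i]; simp,
    fun x => by rw [Equiv.symm_apply_eq, z.a_s]; simp,
    fun x => by rw [Equiv.symm_apply_eq, z.v_t]; simp,
    fun x => by rw [← z.a_bd]; simp⟩

/-- The bijection induced by an isomorphism on neighborhoods. -/
def nb {G H : MGraph} (z : Iso G H) (v : G.V) : G.N v ≃ H.N (z.v v) :=
  z.d.subtypeEquiv fun d => by rw [← z.v_t]; exact z.v.injective.eq_iff.symm

theorem nb_coe {G H : MGraph} (z : Iso G H) (v : G.V) (n : G.N v) :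
    ((z.nb v n : H.N (z.v v)) : H.D) = z.d n := rfl

/-- The bijection induced by an isomorphism on boundaries. -/
def bdEquiv {G H : MGraph} (z : Iso G H) : G.bd ≃ H.bd :=
  z.a.subtypeEquiv fun x => (z.a_bd x).symm

theorem connected {G H : MGraph} (z : Iso G H) (h : G.Connected) : H.Connected := by
  refine ⟨h.1.imp (fun ⟨x⟩ => ⟨z.a x⟩) (fun ⟨x⟩ => ⟨z.v x⟩), fun P Q hi hs => ?_⟩
  have := h.2 (fun a => P (z.a a)) (fun v => Q (z.v v)) (fun a => by rw [z.a_i]; exact hi _)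
    (fun d => by rw [z.a_s, z.v_t]; exact hs _)
  refine this.imp (fun ⟨h1, h2⟩ => ⟨fun a => ?_, fun v => ?_⟩)
    (fun ⟨h1, h2⟩ => ⟨fun a => ?_, fun v => ?_⟩)
  · simpa using h1 (z.a.symm a)
  · simpa using h2 (z.v.symm v)
  · simpa using h1 (z.a.symm a)
  · simpa using h2 (z.v.symm v)

end Iso

theorem mem_bd_of_i_s {G : MGraph} {d : G.D} (h : G.i (G.s d) ∉ Set.range G.s) :
    G.i (G.s d) ∈ G.bd := G.sub_bd ⟨⟨_, ⟨d, rfl⟩, rfl⟩, h⟩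

theorem not_bd_s {G : MGraph} (d : G.D) : G.s d ∉ G.bd := fun h => G.bd_sub h ⟨d, rfl⟩

theorem i_inj (G : MGraph) : Function.Injective G.i := fun a b h => by
  rw [← G.i_i a, h, G.i_i]

theorem mem_i_s_iff {G : MGraph} (a : G.A) :
    a ∈ G.i '' Set.range G.s ↔ G.i a ∈ Set.range G.s := by
  constructor
  · rintro ⟨_, ⟨d, rfl⟩, rfl⟩; exact ⟨d, (G.i_i _).symm⟩
  · rintro ⟨d, h⟩; exact ⟨_, ⟨d, rfl⟩, by rw [h, G.i_i]⟩

/-! ## Graph substitution -/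

/-- The data for a graph substitution into `G`: a graph `H v` for each vertex `v` of `G`, together
with a bijection from the neighborhood of `v` to the boundary of `H v`. (The involution identifies
`N v` with the set of arcs `i (N v)` pointing away from `v`.) -/
structure Filling (G : MGraph) where
  H : G.V → MGraph
  m : ∀ v, G.N v ≃ (H v).bd

namespace Filling

variable {G : MGraph} (F : Filling G)

/-- Arcs of `G` and of all the `H v`, before gluing. -/
abbrev Pre : Type := G.A ⊕ (Σ v, (F.H v).A)

/-- The involution before gluing. -/
def preI : F.Pre → F.Pre
  | Sum.inl a => Sum.inl (G.i a)
  | Sum.inr ⟨v, h⟩ => Sum.inr ⟨v, (F.H v).i h⟩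

/-- The gluing relation: an arc pointing away from the vertex `v` is glued to the corresponding
boundary arc of `H v`, and likewise for the opposite arcs.
(It is oriented so that it follows a path along the direction of the arcs.) -/
inductive Step : F.Pre → F.Pre → Prop
  | enter (v : G.V) (n : G.N v) :
      Step (Sum.inl (G.s n)) (Sum.inr ⟨v, (F.H v).i (F.m v n)⟩)
  | exit (v : G.V) (n : G.N v) :
      Step (Sum.inr ⟨v, F.m v n⟩) (Sum.inl (G.i (G.s n)))

theorem preI_preI (x : F.Pre) : F.preI (F.preI x) = x := by
  rcases x with a | ⟨v, h⟩ <;> simp [preI, i_i]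

theorem preI_ne (x : F.Pre) : F.preI x ≠ x := by
  rcases x with a | ⟨v, h⟩ <;> simp [preI, i_ne]

theorem step_preI {x y : F.Pre} (h : F.Step x y) : F.Step (F.preI y) (F.preI x) := by
  rcases h with ⟨v, n⟩ | ⟨v, n⟩
  · simpa [preI, i_i] using Step.exit (F := F) v n
  · simpa [preI, i_i] using Step.enter (F := F) v n

theorem step_side {x y : F.Pre} (h : F.Step x y) : x.isLeft ≠ y.isLeft := by
  rcases h with ⟨v, n⟩ | ⟨v, n⟩ <;> simp

theorem step_right {x y z : F.Pre} (h : F.Step x y) (h' : F.Step x z) : y = z := by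
  rcases h with ⟨v, n⟩ | ⟨v, n⟩
  · generalize hx : (Sum.inl (G.s n) : F.Pre) = x at h'
    rcases h' with ⟨w, k⟩ | ⟨w, k⟩
    · have h1 := G.s_inj (Sum.inl_injective hx)
      obtain ⟨n, rfl⟩ := n
      obtain ⟨k, rfl⟩ := k
      dsimp at h1
      subst h1
      rfl
    · cases hx
  · generalize hx : (Sum.inr ⟨v, F.m v n⟩ : F.Pre) = x at h'
    rcases h' with ⟨w, k⟩ | ⟨w, k⟩
    · cases hx
    · have h1 := Sum.inr_injective hx
      obtain ⟨rfl, h2⟩ := Sigma.mk.inj_iff.1 h1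
      have h3 := (F.m v).injective (Subtype.ext (eq_of_heq h2))
      rw [h3]

theorem step_left {x y z : F.Pre} (h : F.Step x z) (h' : F.Step y z) : x = y := by
  have := F.step_right (F.step_preI h) (F.step_preI h')
  rw [← F.preI_preI x, this, preI_preI]

open Relation in
theorem not_chain (n : ℕ) : ∀ x (p : ℕ → F.Pre), p 0 = x → p n = F.preI x →
    (∀ k < n, F.Step (p k) (p (k + 1))) → False := by
  induction n using Nat.strong_induction_on with
  | _ n ih =>
    intro x p h0 hn hs
    rcases n with _ | _ | n
    · exact F.preI_ne x (hn.symm.trans h0)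
    · have := F.step_side (hs 0 (by omega))
      rw [hn, h0] at this
      rcases x with a | ⟨v, h⟩ <;> simp [preI] at this
    · refine ih n (by omega) (p 1) (fun k => p (k + 1)) rfl ?_ (fun k hk => hs (k + 1) (by omega))
      have h1 := F.step_preI (hs 0 (by omega))
      rw [h0, ← hn] at h1
      exact F.step_left (hs (n + 1) (by omega)) h1

open Relation in
theorem exists_chain {x y : F.Pre} (h : ReflTransGen F.Step x y) :
    ∃ (n : ℕ) (p : ℕ → F.Pre), p 0 = x ∧ p n = y ∧ ∀ k < n, F.Step (p k) (p (k + 1)) := by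
  induction h with
  | refl => exact ⟨0, fun _ => x, rfl, rfl, by simp⟩
  | @tail b c _ hbc ih =>
    obtain ⟨n, p, h0, hn, hs⟩ := ih
    refine ⟨n + 1, fun k => if k ≤ n then p k else c, by simp [h0], by simp, fun k hk => ?_⟩
    rcases Nat.lt_succ_iff_lt_or_eq.1 hk with h | rfl
    · simpa [h.le, Nat.succ_le_of_lt h] using hs k h
    · simpa [hn] using hbc

open Relation in
theorem not_reach (x : F.Pre) : ¬ ReflTransGen F.Step x (F.preI x) := fun h => by
  obtain ⟨n, p, h0, hn, hs⟩ := F.exists_chain h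
  exact F.not_chain n x p h0 hn hs

open Relation in
theorem reach_of_eqvGen {x y : F.Pre} (h : EqvGen F.Step x y) :
    ReflTransGen F.Step x y ∨ ReflTransGen F.Step y x := by
  induction h with
  | rel x y h => exact Or.inl (.single h)
  | refl x => exact Or.inl .refl
  | symm x y _ ih => exact ih.symm
  | trans x y z _ _ h1 h2 =>
    have tot : ∀ {a b c : F.Pre}, ReflTransGen F.Step a b → ReflTransGen F.Step a c →
        ReflTransGen F.Step b c ∨ ReflTransGen F.Step c b := fun hab hac =>
      ReflTransGen.total_of_right_unique (fun _ _ _ => F.step_right) hab hac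
    have tot' : ∀ {a b c : F.Pre}, ReflTransGen F.Step b a → ReflTransGen F.Step c a →
        ReflTransGen F.Step b c ∨ ReflTransGen F.Step c b := fun hba hca => by
      have := ReflTransGen.total_of_right_unique (r := Function.swap F.Step)
        (fun _ _ _ h h' => F.step_left h h')
        (reflTransGen_swap.2 hba) (reflTransGen_swap.2 hca)
      rcases this with h | h
      · exact Or.inr (reflTransGen_swap.1 h)
      · exact Or.inl (reflTransGen_swap.1 h)
    rcases h1 with h1 | h1 <;> rcases h2 with h2 | h2
    · exact Or.inl (h1.trans h2)
    · exact tot' h1 h2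
    · exact tot h1 h2
    · exact Or.inr (h2.trans h1)

/-- The arcs of the graph substitution: the colimit which glues each arc of `G` pointing away from a
vertex `v` to the corresponding boundary arc of `H v`. If `G` has a vertex and is connected, then all
arcs of `G` are glued to arcs of some `H v`; if `G` has no vertices, the substitution is `G`. -/
def Arc : Type := Quot F.Step

def aL (a : G.A) : F.Arc := Quot.mk _ (Sum.inl a)

def aR (v : G.V) (h : (F.H v).A) : F.Arc := Quot.mk _ (Sum.inr ⟨v, h⟩)

theorem glue (v : G.V) (n : G.N v) : F.aL (G.i (G.s n)) = F.aR v (F.m v n) :=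
  (Quot.sound (Step.exit v n)).symm

theorem glue' (v : G.V) (n : G.N v) : F.aL (G.s n) = F.aR v ((F.H v).i (F.m v n)) :=
  Quot.sound (Step.enter v n)

theorem arc_ind {P : F.Arc → Prop} (hL : ∀ a, P (F.aL a)) (hR : ∀ v h, P (F.aR v h)) (x) : P x := by
  induction x using Quot.ind with
  | mk x => rcases x with a | ⟨v, h⟩; exacts [hL a, hR v h]

/-- Maps out of the arcs of a graph substitution. -/
def arcLift {Z : Type*} (fL : G.A → Z) (fR : ∀ v, (F.H v).A → Z)
    (h : ∀ v (n : G.N v), fL (G.i (G.s n)) = fR v (F.m v n))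
    (h' : ∀ v (n : G.N v), fL (G.s n) = fR v ((F.H v).i (F.m v n))) : F.Arc → Z :=
  Quot.lift (Sum.elim fL fun x => fR x.1 x.2) (by
    rintro _ _ (⟨v, n⟩ | ⟨v, n⟩)
    · exact h' v n
    · exact (h v n).symm)

/-- The involution on the arcs of the graph substitution. -/
def arcI : F.Arc → F.Arc :=
  F.arcLift (fun a => F.aL (G.i a)) (fun v h => F.aR v ((F.H v).i h))
    (fun v n => by rw [G.i_i]; exact F.glue' v n) (fun v n => by rw [i_i]; exact F.glue v n)

theorem mk_eq_iff {x y : F.Pre} : (Quot.mk _ x : F.Arc) = Quot.mk _ y ↔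
    Relation.ReflTransGen F.Step x y ∨ Relation.ReflTransGen F.Step y x := by
  constructor
  · intro h; exact F.reach_of_eqvGen (Quot.eqvGen_exact h)
  · rintro (h | h)
    · exact Quot.eqvGen_sound (Relation.EqvGen.mono (fun _ _ h => h) _ _ (by
        induction h with
        | refl => exact .refl _
        | tail _ h ih => exact .trans _ _ _ ih (.rel _ _ h)))
    · refine (Quot.eqvGen_sound ?_).symm
      induction h with
      | refl => exact .refl _
      | tail _ h ih => exact .trans _ _ _ ih (.rel _ _ h)

/-- No step leads out of `x`. -/
def Term (x : F.Pre) : Prop := ∀ y, ¬ F.Step x y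

theorem eq_of_term {x y : F.Pre} (hx : F.Term x) (hy : F.Term y)
    (h : (Quot.mk _ x : F.Arc) = Quot.mk _ y) : x = y := by
  rcases (F.mk_eq_iff).1 h with h | h
  · rcases Relation.ReflTransGen.cases_head h with h | ⟨z, h, _⟩
    · exact h
    · exact (hx _ h).elim
  · rcases Relation.ReflTransGen.cases_head h with h | ⟨z, h, _⟩
    · exact h.symm
    · exact (hy _ h).elim

theorem term_inl {a : G.A} : F.Term (Sum.inl a) ↔ a ∉ Set.range G.s := by
  constructor
  · rintro h ⟨d, rfl⟩
    exact h _ (Step.enter (G.t d) ⟨d, rfl⟩)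
  · rintro h y hy
    generalize hx : (Sum.inl a : F.Pre) = x at hy
    rcases hy with ⟨w, k⟩ | ⟨w, k⟩
    · exact h ⟨k, (Sum.inl_injective hx).symm⟩
    · cases hx

theorem term_inr {v : G.V} {h : (F.H v).A} : F.Term (Sum.inr ⟨v, h⟩) ↔ h ∉ (F.H v).bd := by
  constructor
  · intro ht hb
    have := Step.exit (F := F) v ((F.m v).symm ⟨h, hb⟩)
    rw [Equiv.apply_symm_apply] at this
    exact ht _ this
  · rintro hb y hy
    generalize hx : (Sum.inr ⟨v, h⟩ : F.Pre) = x at hy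
    rcases hy with ⟨w, k⟩ | ⟨w, k⟩
    · cases hx
    · obtain ⟨rfl, h2⟩ := Sigma.mk.inj_iff.1 (Sum.inr_injective hx)
      exact hb ((eq_of_heq h2) ▸ (F.m v k).2)

theorem term_s (v : G.V) (d : (F.H v).D) : F.Term (Sum.inr ⟨v, (F.H v).s d⟩) :=
  F.term_inr.2 (not_bd_s d)

theorem exists_term (x : F.Pre) (hx : F.Term (F.preI x)) :
    ∃ y, Relation.ReflTransGen F.Step x y ∧ F.Term y := by
  by_contra hcon
  push Not at hcon
  have hstep : ∀ y : {y // Relation.ReflTransGen F.Step x y},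
      ∃ z : {y // Relation.ReflTransGen F.Step x y}, F.Step y z := by
    rintro ⟨y, hy⟩
    have := hcon y hy
    simp only [Term, not_forall, not_not] at this
    obtain ⟨z, hz⟩ := this
    exact ⟨⟨z, hy.tail hz⟩, hz⟩
  choose nx hnx using hstep
  have hinj : Function.Injective nx := fun a b h => by
    have h1 := hnx a
    rw [h] at h1
    exact Subtype.ext (F.step_left h1 (hnx b))
  obtain ⟨z, hz⟩ := (Finite.injective_iff_surjective.1 hinj) ⟨x, .refl⟩
  have := hnx z
  rw [hz] at this
  exact hx _ (F.step_preI this)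

/-- The result of the last step of a path ending in a terminal arc: either it is the start, or it
is an arc in the boundary of `G`, or it is in the image of `s`. -/
theorem term_cases {x y : F.Pre} (h : Relation.ReflTransGen F.Step x y) (hy : F.Term y) :
    x = y ∨ (∃ a ∈ G.bd, y = Sum.inl a) ∨ (∃ v d, y = Sum.inr ⟨v, (F.H v).s d⟩) := by
  rcases Relation.ReflTransGen.cases_tail h with h | ⟨z, _, h⟩
  · exact Or.inl h.symm
  · right
    rcases h with ⟨v, n⟩ | ⟨v, n⟩
    · right
      rw [term_inr] at hy
      by_contra hcon
      push Not at hcon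
      have h1 : (F.m v n : (F.H v).A) ∈ (F.H v).bd \ ((F.H v).i '' Set.range (F.H v).s) := by
        refine ⟨(F.m v n).2, fun h => ?_⟩
        rw [mem_i_s_iff] at h
        obtain ⟨d, hd⟩ := h
        exact hcon v d (by rw [hd])
      exact hy ((F.H v).bd_closed _ h1).1
    · left
      exact ⟨_, mem_bd_of_i_s (F.term_inl.1 hy), rfl⟩

/-- The underlying map `s` of the graph substitution. -/
def arcS (d : Σ v, (F.H v).D) : F.Arc := F.aR d.1 ((F.H d.1).s d.2)

theorem arcS_inj : Function.Injective F.arcS := by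
  rintro ⟨v, d⟩ ⟨w, e⟩ h
  have := Sum.inr_injective (F.eq_of_term (F.term_s v d) (F.term_s w e) h)
  obtain ⟨rfl, h2⟩ := Sigma.mk.inj_iff.1 this
  rw [(F.H v).s_inj (eq_of_heq h2)]

theorem arcI_mk (x : F.Pre) : F.arcI (Quot.mk _ x) = Quot.mk _ (F.preI x) := by
  rcases x with a | ⟨v, h⟩ <;> rfl

theorem arcI_arcI : ∀ x, F.arcI (F.arcI x) = x :=
  F.arc_ind (fun a => congrArg F.aL (G.i_i a)) (fun v h => congrArg (F.aR v) ((F.H v).i_i h))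

theorem aL_bd_inj {a b : G.A} (ha : a ∈ G.bd) (hb : b ∈ G.bd) (h : F.aL a = F.aL b) : a = b :=
  Sum.inl_injective (F.eq_of_term (F.term_inl.2 (G.bd_sub ha)) (F.term_inl.2 (G.bd_sub hb)) h)

theorem aL_bd_ne_arcS {a : G.A} (ha : a ∈ G.bd) (d) : F.aL a ≠ F.arcS d := fun h => by
  have := F.eq_of_term (F.term_inl.2 (G.bd_sub ha)) (F.term_s d.1 d.2) h
  cases this

/-- The graph obtained by substituting the graphs `H v` for the vertices `v` of `G`. Its boundary is
the image of the boundary of `G`. -/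
def subst : MGraph where
  A := F.Arc
  D := Σ v, (F.H v).D
  V := Σ v, (F.H v).V
  finA := Finite.of_surjective (Quot.mk _) Quot.mk_surjective
  finD := inferInstance
  finV := inferInstance
  i := F.arcI
  s := F.arcS
  t := fun d => ⟨d.1, (F.H d.1).t d.2⟩
  bd := F.aL '' G.bd
  bd_sub := by
    rintro _ ⟨a, ha, rfl⟩ ⟨d, hd⟩
    exact F.aL_bd_ne_arcS ha d hd.symm
  i_i := F.arcI_arcI
  i_ne := fun x h => by
    induction x using Quot.ind with
    | mk x =>
      rcases F.mk_eq_iff.1 ((F.arcI_mk x).symm.trans h) with h | h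
      · exact F.not_reach (F.preI x) (by rwa [preI_preI])
      · exact F.not_reach x h
  s_inj := F.arcS_inj
  sub_bd := by
    rintro _ ⟨⟨_, ⟨⟨v, d⟩, rfl⟩, rfl⟩, h⟩
    obtain ⟨y, hy, ht⟩ := F.exists_term (Sum.inr ⟨v, (F.H v).i ((F.H v).s d)⟩)
      (by simpa [preI, i_i] using F.term_s v d)
    have hq : F.arcI (F.arcS ⟨v, d⟩) = Quot.mk _ y := F.mk_eq_iff.2 (Or.inl hy)
    rcases F.term_cases hy ht with rfl | ⟨a, ha, rfl⟩ | ⟨w, e, rfl⟩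
    · rw [term_inr] at ht
      by_cases h1 : (F.H v).i ((F.H v).s d) ∈ Set.range (F.H v).s
      · obtain ⟨e, he⟩ := h1
        exact (h ⟨⟨v, e⟩, by rw [hq, ← he]; rfl⟩).elim
      · exact (ht (mem_bd_of_i_s h1)).elim
    · exact ⟨a, ha, hq.symm⟩
    · exact (h ⟨⟨w, e⟩, hq.symm⟩).elim
  bd_closed := by
    rintro _ ⟨⟨b, hb, rfl⟩, h⟩
    have hni : F.arcI (F.aL b) ∉ Set.range F.arcS := by
      rintro ⟨d, hd⟩
      refine h ⟨_, ⟨d, rfl⟩, ?_⟩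
      rw [hd]
      exact congrArg F.aL (G.i_i b)
    have hni' : F.arcI (F.aL b) ∉ F.arcI '' Set.range F.arcS := by
      rintro ⟨_, ⟨d, rfl⟩, hd⟩
      have h2 := congrArg F.arcI hd
      induction d using Sigma.rec with
      | mk v d =>
      rw [show F.arcI (F.arcI (F.aL b)) = F.aL b from congrArg F.aL (G.i_i b),
        show F.arcI (F.arcI (F.arcS ⟨v, d⟩)) = F.arcS ⟨v, d⟩ from
          congrArg (F.aR v) ((F.H v).i_i _)] at h2
      exact F.aL_bd_ne_arcS hb _ h2.symm
    refine ⟨?_, hni'⟩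
    obtain ⟨y, hy, ht⟩ := F.exists_term (Sum.inl (G.i b))
      (by simpa [preI, i_i] using F.term_inl.2 (G.bd_sub hb))
    have hq : F.arcI (F.aL b) = Quot.mk _ y := F.mk_eq_iff.2 (Or.inl hy)
    rcases F.term_cases hy ht with rfl | ⟨a, ha, rfl⟩ | ⟨w, e, rfl⟩
    · rw [term_inl] at ht
      refine ⟨G.i b, (G.bd_closed b ⟨hb, fun hh => ?_⟩).1, rfl⟩
      exact ht ((mem_i_s_iff b).1 hh)
    · exact ⟨a, ha, hq.symm⟩
    · exact (hni ⟨⟨w, e⟩, hq.symm⟩).elim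

theorem subst_connected (hG : G.Connected) (hH : ∀ v, (F.H v).Connected) :
    F.subst.Connected := by
  have hne : ∀ v, Nonempty F.subst.A ∨ Nonempty F.subst.V := fun v =>
    (hH v).1.imp (fun ⟨a⟩ => ⟨F.aR v a⟩) (fun ⟨w⟩ => ⟨⟨v, w⟩⟩)
  refine ⟨hG.1.elim (fun ⟨a⟩ => Or.inl ⟨F.aL a⟩) (fun ⟨v⟩ => hne v), fun P Q hi hs => ?_⟩
  have hv : ∀ v, ((∀ a, P (F.aR v a)) ∧ ∀ w, Q ⟨v, w⟩) ∨
      ((∀ a, ¬ P (F.aR v a)) ∧ ∀ w, ¬ Q ⟨v, w⟩) := fun v =>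
    (hH v).2 (fun a => P (F.aR v a)) (fun w => Q ⟨v, w⟩) (fun a => hi (F.aR v a))
      (fun d => hs ⟨v, d⟩)
  have := hG.2 (fun a => P (F.aL a)) (fun v => (∀ a, P (F.aR v a)) ∧ ∀ w, Q ⟨v, w⟩)
    (fun a => hi (F.aL a)) (fun d => by
      rw [F.glue' (G.t d) ⟨d, rfl⟩]
      rcases hv (G.t d) with h | h
      · exact iff_of_true (h.1 _) h
      · refine iff_of_false (h.1 _) fun h' => h.1 _ (h'.1 (F.m (G.t d) ⟨d, rfl⟩)))
  rcases this with ⟨h1, h2⟩ | ⟨h1, h2⟩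
  · exact Or.inl ⟨F.arc_ind h1 fun v h => (h2 v).1 h, fun x => (h2 x.1).2 x.2⟩
  · have hv' := fun v => (hv v).resolve_left (h2 v)
    exact Or.inr ⟨F.arc_ind h1 fun v h => (hv' v).1 h, fun x => (hv' x.1).2 x.2⟩

/-- The canonical identification of the boundary of `G` with that of the graph substitution. -/
noncomputable def bdEquiv : G.bd ≃ F.subst.bd :=
  Equiv.Set.imageOfInjOn F.aL G.bd fun _ ha _ hb h => F.aL_bd_inj ha hb h

theorem bdEquiv_coe (b : G.bd) : (F.bdEquiv b).1 = F.aL b := rfl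

/-- The canonical identification of neighborhoods. -/
def nbEquiv (v : G.V) (w : (F.H v).V) : (F.H v).N w ≃ F.subst.N ⟨v, w⟩ where
  toFun n := ⟨⟨v, n.1⟩, by obtain ⟨n, rfl⟩ := n; rfl⟩
  invFun n := ⟨(Sigma.mk.inj_iff.1 n.2).1 ▸ n.1.2, by
    obtain ⟨⟨v', d⟩, h⟩ := n
    obtain ⟨rfl, h⟩ := Sigma.mk.inj_iff.1 h
    exact eq_of_heq h⟩
  left_inv := fun _ => rfl
  right_inv := by
    rintro ⟨⟨v', d⟩, h⟩
    obtain ⟨rfl, h⟩ := Sigma.mk.inj_iff.1 h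
    rfl

theorem nbEquiv_coe (v : G.V) (w : (F.H v).V) (n) : (F.nbEquiv v w n).1 = ⟨v, n.1⟩ := rfl

/-- Graph substitution is invariant under isomorphism: the map on arcs. -/
def arcCongr {G' : MGraph} {F : Filling G} {F' : Filling G'} (z : Iso G G')
    (zv : ∀ v, Iso (F.H v) (F'.H (z.v v)))
    (h : ∀ v n, ((zv v).a (F.m v n) : (F'.H (z.v v)).A) = F'.m (z.v v) (z.nb v n)) :
    F.Arc ≃ F'.Arc :=
  Quot.congr (Equiv.sumCongr z.a (Equiv.sigmaCongr z.v fun v => (zv v).a)) (by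
    intro x y
    constructor
    · rintro (⟨v, n⟩ | ⟨v, n⟩)
      · have := Step.enter (F := F') (z.v v) (z.nb v n)
        rw [← h, Iso.nb_coe, ← z.a_s, ← (zv v).a_i] at this
        exact this
      · have := Step.exit (F := F') (z.v v) (z.nb v n)
        rw [← h, Iso.nb_coe, ← z.a_s, ← z.a_i] at this
        exact this
    · intro hxy
      generalize hx' : (Equiv.sumCongr z.a (Equiv.sigmaCongr z.v fun v => (zv v).a) : F.Pre ≃ F'.Pre) x = x'
        at hxy
      generalize hy' : (Equiv.sumCongr z.a (Equiv.sigmaCongr z.v fun v => (zv v).a) : F.Pre ≃ F'.Pre) y = y'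
        at hxy
      rcases hxy with ⟨v', n'⟩ | ⟨v', n'⟩
      · obtain ⟨v, rfl⟩ := z.v.surjective v'
        obtain ⟨n, rfl⟩ := (z.nb v).surjective n'
        rw [← h, ← (zv v).a_i] at hy'
        rw [Iso.nb_coe, ← z.a_s] at hx'
        obtain rfl : x = Sum.inl (G.s n) := (Equiv.injective _) hx'
        obtain rfl : y = Sum.inr ⟨v, (F.H v).i (F.m v n)⟩ := (Equiv.injective _) hy'
        exact Step.enter v n
      · obtain ⟨v, rfl⟩ := z.v.surjective v'
        obtain ⟨n, rfl⟩ := (z.nb v).surjective n'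
        rw [← h] at hx'
        rw [Iso.nb_coe, ← z.a_s, ← z.a_i] at hy'
        obtain rfl : x = Sum.inr ⟨v, F.m v n⟩ := (Equiv.injective _) hx'
        obtain rfl : y = Sum.inl (G.i (G.s n)) := (Equiv.injective _) hy'
        exact Step.exit v n)

/-- Graph substitution is invariant under isomorphism. -/
def substCongr {G' : MGraph} {F : Filling G} {F' : Filling G'} (z : Iso G G')
    (zv : ∀ v, Iso (F.H v) (F'.H (z.v v)))
    (h : ∀ v n, ((zv v).a (F.m v n) : (F'.H (z.v v)).A) = F'.m (z.v v) (z.nb v n)) :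
    Iso F.subst F'.subst where
  a := arcCongr z zv h
  d := Equiv.sigmaCongr z.v fun v => (zv v).d
  v := Equiv.sigmaCongr z.v fun v => (zv v).v
  a_i := F.arc_ind (fun a => congrArg F'.aL (z.a_i a))
    (fun v a => congrArg (F'.aR _) ((zv v).a_i a))
  a_s := fun ⟨v, d⟩ => congrArg (F'.aR _) ((zv v).a_s d)
  v_t := fun ⟨v, d⟩ => congrArg (Sigma.mk _) ((zv v).v_t d)
  a_bd := fun x => by
    constructor
    · rintro ⟨b, hb, hx⟩
      obtain ⟨a, rfl⟩ := z.a.surjective b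
      exact ⟨a, (z.a_bd a).1 hb, (arcCongr z zv h).injective hx⟩
    · rintro ⟨b, hb, rfl⟩
      exact ⟨z.a b, (z.a_bd b).2 hb, rfl⟩

/-- Substituting stars does not change the graph: the map on arcs. -/
def arcStar (e : ∀ v, (F.H v).A → G.A) (he : ∀ v n, e v (F.m v n).1 = G.i (G.s n.1))
    (he' : ∀ v n, e v ((F.H v).i (F.m v n).1) = G.s n.1)
    (hs : ∀ v x, ∃ n, x = (F.m v n).1 ∨ x = (F.H v).i (F.m v n).1) : F.Arc ≃ G.A where
  toFun := F.arcLift id e (fun v n => (he v n).symm) (fun v n => (he' v n).symm)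
  invFun := F.aL
  left_inv := F.arc_ind (fun _ => rfl) (by
    intro v x
    obtain ⟨n, rfl | rfl⟩ := hs v x
    · exact (congrArg F.aL (he v n)).trans (F.glue v n)
    · exact (congrArg F.aL (he' v n)).trans (F.glue' v n))
  right_inv := fun _ => rfl

/-- The filling of a graph by stars. -/
noncomputable def stars (G : MGraph) (S : G.V → Type) [∀ v, Finite (S v)] (m : ∀ v, G.N v ≃ S v) :
    Filling G where
  H v := star (S v)
  m v := (m v).trans (Equiv.ofInjective (Sum.inl : S v → S v ⊕ S v) Sum.inl_injective)

/-- Substituting stars does not change the graph. -/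
noncomputable def substStar (G : MGraph) (S : G.V → Type) [∀ v, Finite (S v)] (m : ∀ v, G.N v ≃ S v) :
    Iso (stars G S m).subst G :=
  let a := (stars G S m).arcStar
    (fun v => Sum.elim (fun x => G.i (G.s ((m v).symm x))) (fun x => G.s ((m v).symm x)))
    (fun v n => congrArg (fun n : G.N v => G.i (G.s n)) ((m v).symm_apply_apply n))
    (fun v n => congrArg (fun n : G.N v => G.s n) ((m v).symm_apply_apply n))
    (fun v x => by
      rcases x with x | x
      · exact ⟨(m v).symm x, Or.inl (congrArg Sum.inl ((m v).apply_symm_apply x).symm)⟩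
      · exact ⟨(m v).symm x, Or.inr (congrArg Sum.inr ((m v).apply_symm_apply x).symm)⟩)
  { a := a
    d := (Equiv.sigmaCongrRight fun v => (m v).symm).trans (Equiv.sigmaFiberEquiv G.t)
    v := Equiv.sigmaPUnit G.V
    a_i := (stars G S m).arc_ind (fun _ => rfl) (by
      rintro v (x | x)
      · exact (G.i_i _).symm
      · rfl)
    a_s := fun _ => rfl
    v_t := fun ⟨v, d⟩ => ((m v).symm d).2.symm
    a_bd := fun x => by
      constructor
      · intro h
        exact ⟨_, h, a.left_inv x⟩
      · rintro ⟨b, hb, rfl⟩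
        exact hb }

/-- Substituting a graph for the vertex of a star gives this graph: the map on arcs. -/
def arcIntoStar (S : Type) [Finite S] (F : Filling (star S)) : F.Arc ≃ (F.H ()).A where
  toFun := F.arcLift
    (Sum.elim (fun x => F.m () ⟨x, rfl⟩) (fun x => (F.H ()).i (F.m () ⟨x, rfl⟩)))
    (fun _ x => x) (fun _ _ => rfl) (fun _ _ => rfl)
  invFun := F.aR ()
  left_inv := F.arc_ind (by
      rintro (x | x)
      · exact (F.glue () ⟨x, rfl⟩).symm
      · exact (F.glue' () ⟨x, rfl⟩).symm) (fun _ _ => rfl)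
  right_inv := fun _ => rfl

/-- Substituting a graph for the vertex of a star gives this graph. -/
def substIntoStar (S : Type) [Finite S] (F : Filling (star S)) : Iso F.subst (F.H ()) where
  a := arcIntoStar S F
  d := Equiv.uniqueSigma (fun v : Unit => (F.H v).D)
  v := Equiv.uniqueSigma (fun v : Unit => (F.H v).V)
  a_i := F.arc_ind (by
      rintro (x | x)
      · rfl
      · exact ((F.H ()).i_i _).symm) (fun _ _ => rfl)
  a_s := fun _ => rfl
  v_t := fun _ => rfl
  a_bd := fun x => by
    constructor
    · intro h
      obtain ⟨⟨n, _⟩, hn⟩ := (F.m ()).surjective ⟨_, h⟩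
      refine ⟨Sum.inl n, ⟨n, rfl⟩, (arcIntoStar S F).injective ?_⟩
      exact congrArg Subtype.val hn
    · rintro ⟨_, ⟨b, rfl⟩, rfl⟩
      exact (F.m () ⟨b, rfl⟩).2

/-- The filling of `F.subst` determined by fillings of all the `F.H v`. -/
def inner (E : ∀ v, Filling (F.H v)) : Filling F.subst where
  H x := (E x.1).H x.2
  m x := (F.nbEquiv x.1 x.2).symm.trans ((E x.1).m x.2)

/-- The filling of `G` by the substitutions of fillings of all the `F.H v`. -/
noncomputable def outer (E : ∀ v, Filling (F.H v)) : Filling G where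
  H v := (E v).subst
  m v := (F.m v).trans (E v).bdEquiv

/-- Graph substitution is associative: the map on arcs. -/
noncomputable def arcAssoc (E : ∀ v, Filling (F.H v)) : (F.inner E).Arc ≃ (F.outer E).Arc where
  toFun := (F.inner E).arcLift
    (F.arcLift (F.outer E).aL (fun v h => (F.outer E).aR v ((E v).aL h))
      (fun v n => (F.outer E).glue v n)
      (fun v n => (F.outer E).glue' v n))
    (fun x l => (F.outer E).aR x.1 ((E x.1).aR x.2 l))
    (fun x n => by
      obtain ⟨v, w⟩ := x
      obtain ⟨n, rfl⟩ := (F.nbEquiv v w).surjective n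
      exact congrArg ((F.outer E).aR v) ((E v).glue w n))
    (fun x n => by
      obtain ⟨v, w⟩ := x
      obtain ⟨n, rfl⟩ := (F.nbEquiv v w).surjective n
      exact congrArg ((F.outer E).aR v) ((E v).glue' w n))
  invFun := (F.outer E).arcLift (fun a => (F.inner E).aL (F.aL a))
    (fun v => (E v).arcLift (fun h => (F.inner E).aL (F.aR v h))
      (fun w l => (F.inner E).aR ⟨v, w⟩ l)
      (fun w n => (F.inner E).glue ⟨v, w⟩ (F.nbEquiv v w n))
      (fun w n => (F.inner E).glue' ⟨v, w⟩ (F.nbEquiv v w n)))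
    (fun v n => congrArg (F.inner E).aL (F.glue v n))
    (fun v n => congrArg (F.inner E).aL (F.glue' v n))
  left_inv := (F.inner E).arc_ind (F.arc_ind (fun _ => rfl) (fun _ _ => rfl)) (fun _ _ => rfl)
  right_inv := (F.outer E).arc_ind (fun _ => rfl)
    (fun v => (E v).arc_ind (fun _ => rfl) (fun _ _ => rfl))

/-- Graph substitution is associative. -/
noncomputable def substAssoc (E : ∀ v, Filling (F.H v)) :
    Iso (F.inner E).subst (F.outer E).subst where
  a := F.arcAssoc E
  d := Equiv.sigmaAssoc (fun v w => ((E v).H w).D)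
  v := Equiv.sigmaAssoc (fun v w => ((E v).H w).V)
  a_i := (F.inner E).arc_ind (F.arc_ind (fun _ => rfl) (fun _ _ => rfl)) (fun _ _ => rfl)
  a_s := fun _ => rfl
  v_t := fun _ => rfl
  a_bd := fun x => by
    constructor
    · rintro ⟨b, hb, h⟩
      exact ⟨F.aL b, ⟨b, hb, rfl⟩, (F.arcAssoc E).injective h⟩
    · rintro ⟨_, ⟨b, hb, rfl⟩, rfl⟩
      exact ⟨b, hb, rfl⟩

end Filling
end MGraph
end ModOp

namespace ModOp
namespace MGraph

/-! ## Étale maps and embeddings -/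

/-- Étale maps: natural transformations of the diagrams `A ← D → V`, compatible with the
involutions, such that the square on `D → V` is a pullback, and such that arcs which are neither in
the boundary nor in `D` are sent to arcs which are neither in the boundary nor in `D`. -/
@[ext]
structure Etale (K G : MGraph) where
  a : K.A → G.A
  d : K.D → G.D
  v : K.V → G.V
  a_i : ∀ x, a (K.i x) = G.i (a x)
  a_s : ∀ x, a (K.s x) = G.s (d x)
  v_t : ∀ x, v (K.t x) = G.t (d x)
  pullback : ∀ (y : G.D) (w : K.V), G.t y = v w → ∃! x, d x = y ∧ K.t x = w
  compl : ∀ x, x ∉ K.bd ∪ Set.range K.s → a x ∉ G.bd ∪ Set.range G.s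

/-- The bijection on neighborhoods induced by an étale map. -/
noncomputable def Etale.nb {K G : MGraph} (f : Etale K G) (w : K.V) : K.N w ≃ G.N (f.v w) :=
  Equiv.ofBijective (fun n => ⟨f.d n, by rw [← f.v_t, n.2]⟩) (by
    constructor
    · intro n k h
      obtain ⟨x, _, hx⟩ := f.pullback (f.d n) w (by rw [← f.v_t, n.2])
      exact Subtype.ext ((hx _ ⟨rfl, n.2⟩).trans (hx _ ⟨(congrArg Subtype.val h).symm, k.2⟩).symm)
    · rintro ⟨y, hy⟩
      obtain ⟨x, ⟨hx, hx'⟩, _⟩ := f.pullback y w hy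
      exact ⟨⟨x, hx'⟩, Subtype.ext hx⟩)

theorem Etale.nb_coe {K G : MGraph} (f : Etale K G) (w : K.V) (n : K.N w) :
    (f.nb w n).1 = f.d n := rfl

/-- A connected graph is either safe, or has no vertices and empty boundary. -/
theorem Connected.safe_or {G : MGraph} (hG : G.Connected) :
    (∀ a, a ∈ G.bd ∨ a ∈ Set.range G.s) ∨ (IsEmpty G.V ∧ G.bd = ∅) := by
  by_contra hcon
  push Not at hcon
  obtain ⟨⟨b, hb, hb'⟩, h⟩ := hcon
  have hib' : G.i b ∉ Set.range G.s := by
    rintro ⟨d, hd⟩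
    have := G.i_i b
    rw [← hd] at this
    exact hb (this ▸ mem_bd_of_i_s (by rwa [this]))
  have hib : G.i b ∉ G.bd := fun hh => hb (by
    have := (G.bd_closed (G.i b) ⟨hh, fun h2 => hb' (by
      have := (mem_i_s_iff _).1 h2
      rwa [G.i_i] at this)⟩).1
    rwa [G.i_i] at this)
  rcases hG.2 (fun a => a = b ∨ a = G.i b) (fun _ => False) (fun a => by
      constructor
      · rintro (h | h)
        · exact Or.inr (by rw [← h, G.i_i])
        · exact Or.inl (G.i_inj h)
      · rintro (rfl | rfl)
        · exact Or.inr rfl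
        · exact Or.inl (G.i_i b)) (fun d => by
      refine iff_of_false ?_ id
      rintro (h | h)
      · exact hb' ⟨d, h⟩
      · exact hib' ⟨d, h⟩) with ⟨h1, h2⟩ | ⟨h1, _⟩
  · refine (h ⟨h2⟩).ne_empty (Set.eq_empty_of_forall_notMem fun a ha => ?_)
    rcases h1 a with rfl | rfl
    · exact hb ha
    · exact hib ha
  · exact h1 b (Or.inl rfl)

/-- A connected graph with nonempty boundary and no vertices is an exceptional edge. -/
theorem Connected.iso_edge {G : MGraph} (hG : G.Connected) (hV : IsEmpty G.V)
    (hb : G.bd.Nonempty) : Nonempty (Iso G edge) := by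
  obtain ⟨b, hb⟩ := hb
  have hD : IsEmpty G.D := ⟨fun d => hV.false (G.t d)⟩
  have hs : ∀ a, a ∈ G.bd := fun a => by
    rcases hG.safe_or with h | h
    · exact (h a).resolve_right fun ⟨d, _⟩ => hD.false d
    · exact absurd hb (by simp [h.2])
  have hall : ∀ a, a = b ∨ a = G.i b := by
    rcases hG.2 (fun a => a = b ∨ a = G.i b) (fun _ => False) (fun a => by
      constructor
      · rintro (h | h)
        · exact Or.inr (by rw [← h, G.i_i])
        · exact Or.inl (G.i_inj h)
      · rintro (rfl | rfl)
        · exact Or.inr rfl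
        · exact Or.inl (G.i_i b)) (fun d => (hD.false d).elim) with ⟨h1, _⟩ | ⟨h1, _⟩
    · exact h1
    · exact (h1 b (Or.inl rfl)).elim
  classical
  let f : G.A ≃ Bool := ⟨fun a => decide (a = b), fun x : Bool => if x then b else G.i b,
    fun a => by rcases hall a with rfl | rfl <;> simp [G.i_ne],
    fun x => by cases x <;> simp [G.i_ne]⟩
  refine ⟨⟨f, Equiv.equivOfIsEmpty G.D Empty, Equiv.equivOfIsEmpty G.V Empty, fun x => ?_,
    fun d => (hD.false d).elim, fun d => (hD.false d).elim,
    fun x => iff_of_true trivial (hs x)⟩⟩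
  change decide (G.i x = b) = !(decide (x = b))
  rcases hall x with rfl | rfl <;> simp [G.i_ne, G.i_i]

/-- An embedding with codomain `G`: an étale map from a connected graph which is injective on
vertices. -/
structure BigEmb (G : MGraph) where
  dom : MGraph
  conn : dom.Connected
  map : Etale dom G
  inj : Function.Injective map.v

namespace BigEmb

variable {G : MGraph}

/-- Two embeddings `f`, `h` are equivalent if `f = h z` for an isomorphism `z`. -/
def Rel (f h : BigEmb G) : Prop :=
  ∃ z : Iso f.dom h.dom, (∀ x, f.map.a x = h.map.a (z.a x)) ∧
    (∀ x, f.map.d x = h.map.d (z.d x)) ∧ (∀ x, f.map.v x = h.map.v (z.v x))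

theorem rel_of {f h : BigEmb G} (z : Iso f.dom h.dom) (ha : ∀ x, f.map.a x = h.map.a (z.a x))
    (hv : ∀ x, f.map.v x = h.map.v (z.v x)) : f.Rel h :=
  ⟨z, ha, fun x => G.s_inj (by rw [← f.map.a_s, ha, z.a_s, h.map.a_s]), hv⟩

instance setoid (G : MGraph) : Setoid (BigEmb G) where
  r := Rel
  iseqv :=
    { refl := fun f => ⟨Iso.refl _, fun _ => rfl, fun _ => rfl, fun _ => rfl⟩
      symm := fun ⟨z, h1, h2, h3⟩ => ⟨z.symm, fun x => by simp [h1], fun x => by simp [h2],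
        fun x => by simp [h3]⟩
      trans := fun ⟨z, h1, h2, h3⟩ ⟨w, k1, k2, k3⟩ => ⟨z.trans w, fun x => by simp [h1, k1],
        fun x => by simp [h2, k2], fun x => by simp [h3, k3]⟩ }

theorem inj_aux (f : BigEmb G) {x : f.dom.A} (hx : x ∈ f.dom.bd) (hx' : f.dom.i x ∉ Set.range f.dom.s)
      (y : f.dom.A) (h : f.map.a x = f.map.a y) : x = y := by
    have hxs : x ∉ Set.range f.dom.s := f.dom.bd_sub hx
    rcases f.conn.2 (fun a => a = x ∨ a = f.dom.i x) (fun _ => False) (fun a => by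
      constructor
      · rintro (h | h)
        · exact Or.inr (by rw [← h, f.dom.i_i])
        · exact Or.inl (f.dom.i_inj h)
      · rintro (rfl | rfl)
        · exact Or.inr rfl
        · exact Or.inl (f.dom.i_i _)) (fun d => by
      refine iff_of_false ?_ id
      rintro (h | h)
      · exact hxs ⟨d, h⟩
      · exact hx' ⟨d, h⟩) with ⟨h1, _⟩ | ⟨h1, _⟩
    · rcases h1 y with rfl | rfl
      · rfl
      · rw [f.map.a_i] at h
        exact (G.i_ne _ h.symm).elim
    · exact (h1 x (Or.inl rfl)).elim

/-- Embeddings are injective on boundaries. -/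
theorem injOn_bd (f : BigEmb G) : Set.InjOn f.map.a f.dom.bd := by
  intro x hx y hy h
  by_cases hx' : f.dom.i x ∈ Set.range f.dom.s
  · by_cases hy' : f.dom.i y ∈ Set.range f.dom.s
    · obtain ⟨d, hd⟩ := hx'
      obtain ⟨e, he⟩ := hy'
      have h1 : f.map.d d = f.map.d e := G.s_inj (by
        rw [← f.map.a_s, ← f.map.a_s, hd, he, f.map.a_i, f.map.a_i, h])
      have h2 : f.dom.t d = f.dom.t e := f.inj (by rw [f.map.v_t, f.map.v_t, h1])
      obtain ⟨z, _, hz⟩ := f.map.pullback (f.map.d e) (f.dom.t e) (f.map.v_t e).symm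
      have h3 : d = e := (hz d ⟨h1, h2⟩).trans (hz e ⟨rfl, rfl⟩).symm
      rw [h3, he] at hd
      exact (f.dom.i_inj hd).symm
    · exact f.inj_aux hy hy' x h.symm |>.symm
  · exact f.inj_aux hx hx' y h

/-- The vertex sum of an embedding, in the free commutative monoid on the vertices. -/
noncomputable def vsum (f : BigEmb G) : G.V →₀ ℕ := ∑ᶠ u, Finsupp.single (f.map.v u) 1

/-- The boundary of an embedding, as a set of arcs of the codomain. -/
def bdry (f : BigEmb G) : Set G.A := f.map.a '' f.dom.bd

/-- The domain is an exceptional edge. -/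
def IsEdge (f : BigEmb G) : Prop := Nonempty (Iso f.dom edge)

end BigEmb

/-- Isomorphism classes of embeddings with codomain `G`. -/
def Emb (G : MGraph) : Type 1 := Quotient (BigEmb.setoid G)

namespace Emb

variable {G : MGraph}

def mk (f : BigEmb G) : Emb G := Quotient.mk _ f

theorem exists_rep (x : Emb G) : ∃ f, mk f = x := Quotient.exists_rep x

noncomputable def rep (x : Emb G) : BigEmb G := Quotient.out x

theorem mk_rep (x : Emb G) : mk x.rep = x := Quotient.out_eq x

theorem mk_eq {f h : BigEmb G} : mk f = mk h ↔ f.Rel h := Quotient.eq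

/-- The vertex sum of a class of embeddings. -/
noncomputable def vsum : Emb G → (G.V →₀ ℕ) :=
  Quotient.lift BigEmb.vsum fun f h ⟨z, _, _, hv⟩ => by
    unfold BigEmb.vsum
    simp_rw [hv]
    exact finsum_comp_equiv (f := fun u => Finsupp.single (h.map.v u) 1) z.v

/-- The boundary of a class of embeddings. -/
def bdry : Emb G → Set G.A :=
  Quotient.lift BigEmb.bdry fun f h ⟨z, ha, _, _⟩ => by
    ext y
    constructor
    · rintro ⟨x, hx, rfl⟩
      exact ⟨z.a x, (z.a_bd x).2 hx, (ha x).symm⟩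
    · rintro ⟨x, hx, rfl⟩
      obtain ⟨x, rfl⟩ := z.a.surjective x
      exact ⟨x, (z.a_bd x).1 hx, ha x⟩

/-- The class of embeddings consists of embeddings of the exceptional edge. -/
def IsEdge : Emb G → Prop :=
  Quotient.lift BigEmb.IsEdge fun _ _ ⟨z, _⟩ =>
    propext ⟨fun ⟨w⟩ => ⟨z.symm.trans w⟩, fun ⟨w⟩ => ⟨z.trans w⟩⟩

theorem vsum_mk (f : BigEmb G) : (mk f).vsum = f.vsum := rfl
theorem bdry_mk (f : BigEmb G) : (mk f).bdry = f.bdry := rfl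
theorem isEdge_mk (f : BigEmb G) : (mk f).IsEdge ↔ f.IsEdge := Iff.rfl

end Emb

open Classical in
theorem BigEmb.vsum_apply {G : MGraph} (f : BigEmb G) (w : G.V) :
    f.vsum w = if w ∈ Set.range f.map.v then 1 else 0 := by
  have := Fintype.ofFinite f.dom.V
  unfold BigEmb.vsum
  rw [finsum_eq_sum_of_fintype, Finsupp.finsetSum_apply]
  simp only [Finsupp.single_apply]
  split_ifs with h
  · obtain ⟨u, rfl⟩ := h
    simp [f.inj.eq_iff]
  · exact Finset.sum_eq_zero fun u _ => if_neg fun hu => h ⟨u, hu⟩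

theorem noDouble_iff {V : Type} [Finite V] {G : MGraph} (R : V → BigEmb G) :
    ∑ᶠ v, (Emb.mk (R v)).vsum ≤ ∑ᶠ w : G.V, Finsupp.single w 1 ↔
      ∀ v v' u u', (R v).map.v u = (R v').map.v u' → v = v' := by
  classical
  have := Fintype.ofFinite V
  have := Fintype.ofFinite G.V
  have key : (∑ᶠ v, (Emb.mk (R v)).vsum ≤ ∑ᶠ w : G.V, Finsupp.single w 1) ↔
      ∀ w, (Finset.univ.filter fun v => w ∈ Set.range (R v).map.v).card ≤ 1 := by
    rw [finsum_eq_sum_of_fintype, finsum_eq_sum_of_fintype, Finsupp.le_def]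
    refine forall_congr' fun w => ?_
    rw [Finsupp.finsetSum_apply, Finsupp.finsetSum_apply]
    simp only [Emb.vsum_mk, BigEmb.vsum_apply, Finsupp.single_apply, Finset.sum_ite_eq',
      Finset.sum_boole]
    simp
  rw [key]
  constructor
  · intro h v v' u u' huu
    exact Finset.card_le_one.1 (h ((R v).map.v u)) v (by simp) v' (by simp [huu])
  · intro h w
    refine Finset.card_le_one.2 fun v hv v' hv' => ?_
    obtain ⟨u, hu⟩ := (Finset.mem_filter.1 hv).2
    obtain ⟨u', hu'⟩ := (Finset.mem_filter.1 hv').2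
    exact h v v' u u' (hu.trans hu'.symm)

/-! ## The graphical category -/

/-- Graphical maps `G → G'`: an involutive map `zero` on arcs and a function `one` from vertices to
classes of embeddings into `G'`, such that
* the sum over all vertices `v` of the vertex sums of `one v` is at most the sum of all vertices of
  `G'`, in the free commutative monoid on the vertices of `G'`;
* for each `v`, the map `zero ∘ i` restricts to a bijection from the neighborhood of `v` to the
  boundary of `one v`;
* if the boundary of `G` is empty, then some `one v` is not an edge. -/
@[ext]
structure GMap (G G' : MGraph) where
  zero : G.A → G'.A
  one : G.V → Emb G'
  zero_i : ∀ a, zero (G.i a) = G'.i (zero a)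
  noDouble : ∑ᶠ v, (one v).vsum ≤ ∑ᶠ w : G'.V, Finsupp.single w 1
  boundary : ∀ v, Set.BijOn (fun d => zero (G.i (G.s d))) {d | G.t d = v} (one v).bdry
  collapse : G.bd = ∅ → ∃ v, ¬ (one v).IsEdge

namespace GMap

variable {G G' : MGraph}

theorem disj (ψ : GMap G G') {v v' : G.V} {r r' : BigEmb G'} (hr : Emb.mk r = ψ.one v)
    (hr' : Emb.mk r' = ψ.one v') {u u'} (h : r.map.v u = r'.map.v u') : v = v' := by
  have h1 := ψ.noDouble
  obtain ⟨R, hR⟩ : ∃ R : G.V → BigEmb G', ∀ v, Emb.mk (R v) = ψ.one v :=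
    ⟨fun v => (ψ.one v).rep, fun v => Emb.mk_rep _⟩
  simp_rw [← hR] at h1
  obtain ⟨z, _, _, hz⟩ := Emb.mk_eq.1 (hr.trans (hR v).symm)
  obtain ⟨z', _, _, hz'⟩ := Emb.mk_eq.1 (hr'.trans (hR v').symm)
  rw [hz, hz'] at h
  exact (noDouble_iff R).1 h1 _ _ _ _ h

end GMap

/-- The bijection from the neighborhood of `v` to the boundary of a representative of the class of
embeddings assigned to `v`. -/
theorem GMap.exists_bdEquiv {G G' : MGraph} (ψ : GMap G G') (v : G.V) (r : BigEmb G')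
    (hr : Emb.mk r = ψ.one v) :
    ∃ m : G.N v ≃ r.dom.bd, ∀ n, r.map.a (m n).1 = ψ.zero (G.i (G.s n.1)) := by
  have h := ψ.boundary v
  rw [← hr] at h
  let g : r.dom.bd ≃ (r.bdry : Set G'.A) := Equiv.Set.imageOfInjOn r.map.a r.dom.bd r.injOn_bd
  refine ⟨(h.equiv).trans g.symm, fun n => ?_⟩
  obtain ⟨b, hb⟩ := g.surjective (h.equiv _ n)
  change r.map.a (g.symm (h.equiv _ n)).1 = _
  rw [← hb, Equiv.symm_apply_apply]
  exact congrArg Subtype.val hb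

noncomputable def GMap.bdEquiv {G G' : MGraph} (ψ : GMap G G') (v : G.V) (r : BigEmb G')
    (hr : Emb.mk r = ψ.one v) : G.N v ≃ r.dom.bd := (ψ.exists_bdEquiv v r hr).choose

theorem GMap.bdEquiv_spec {G G' : MGraph} (ψ : GMap G G') (v : G.V) (r : BigEmb G')
    (hr : Emb.mk r = ψ.one v) (n) :
    r.map.a (ψ.bdEquiv v r hr n).1 = ψ.zero (G.i (G.s n.1)) :=
  (ψ.exists_bdEquiv v r hr).choose_spec n

end MGraph

open MGraph

/-- The objects of the graphical category: safe connected graphs. -/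
structure U where
  graph : MGraph
  safe : graph.Safe
  conn : graph.Connected

namespace U

theorem mem_or (G : U) (a) : a ∈ G.graph.bd ∨ a ∈ Set.range G.graph.s := by
  by_cases h : a ∈ Set.range G.graph.s
  · exact Or.inr h
  · exact Or.inl (by rw [G.safe]; exact h)

theorem emb_mem_or {G : U} (e : BigEmb G.graph) (a) : a ∈ e.dom.bd ∨ a ∈ Set.range e.dom.s := by
  by_contra h
  exact e.map.compl a h (G.mem_or _)

theorem isEdge_iff {G : U} (e : BigEmb G.graph) : e.IsEdge ↔ IsEmpty e.dom.V := by
  constructor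
  · rintro ⟨z⟩
    exact ⟨fun v => (z.v v).elim⟩
  · intro h
    refine e.conn.iso_edge h ?_
    obtain ⟨a⟩ := e.conn.1.resolve_right fun ⟨v⟩ => h.false v
    exact ⟨a, (emb_mem_or e a).resolve_right fun ⟨d, _⟩ => h.false (e.dom.t d)⟩

/-- An embedding with empty boundary is surjective on vertices, and its codomain has empty
boundary. -/
theorem onto {G : U} (e : BigEmb G.graph) (he : e.dom.bd = ∅) :
    Function.Surjective e.map.v ∧ G.graph.bd = ∅ := by
  have hD : ∀ a, a ∈ Set.range e.dom.s := fun a =>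
    (emb_mem_or e a).resolve_left (by simp [he])
  rcases G.conn.2 (fun a => a ∈ Set.range e.map.a) (fun v => v ∈ Set.range e.map.v)
    (fun a => by
      constructor
      · rintro ⟨x, hx⟩; exact ⟨e.dom.i x, by rw [e.map.a_i, hx, MGraph.i_i]⟩
      · rintro ⟨x, hx⟩; exact ⟨e.dom.i x, by rw [e.map.a_i, hx]⟩)
    (fun d => by
      constructor
      · rintro ⟨x, hx⟩
        obtain ⟨y, rfl⟩ := hD x
        rw [e.map.a_s] at hx
        exact ⟨e.dom.t y, by rw [e.map.v_t, G.graph.s_inj hx]⟩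
      · rintro ⟨w, hw⟩
        obtain ⟨x, ⟨hx, _⟩, _⟩ := e.map.pullback d w hw.symm
        exact ⟨e.dom.s x, by rw [e.map.a_s, hx]⟩) with ⟨h1, h2⟩ | ⟨h1, h2⟩
  · refine ⟨h2, Set.eq_empty_of_forall_notMem fun a ha => ?_⟩
    obtain ⟨x, rfl⟩ := h1 a
    obtain ⟨y, rfl⟩ := hD x
    rw [e.map.a_s] at ha
    exact not_bd_s _ ha
  · rcases e.conn.1 with ⟨⟨a⟩⟩ | ⟨⟨v⟩⟩
    · exact (h1 _ ⟨a, rfl⟩).elim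
    · exact (h2 _ ⟨v, rfl⟩).elim

end U

section Comp

variable {G G' G'' : U}

/-- The filling of the domain of an embedding into `G` by the domains of the embeddings into `G'`
assigned by a graphical map `ψ : G → G'` to the vertices. -/
noncomputable def compFill (e : BigEmb G.graph) (ψ : GMap G.graph G'.graph)
    (R : e.dom.V → BigEmb G'.graph) (hR : ∀ w, Emb.mk (R w) = ψ.one (e.map.v w)) :
    Filling e.dom where
  H w := (R w).dom
  m w := (e.map.nb w).trans (ψ.bdEquiv _ (R w) (hR w))

theorem compFill_m (e : BigEmb G.graph) (ψ : GMap G.graph G'.graph)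
    (R : e.dom.V → BigEmb G'.graph) (hR : ∀ w, Emb.mk (R w) = ψ.one (e.map.v w)) (w n) :
    (R w).map.a ((compFill e ψ R hR).m w n).1 = ψ.zero (e.map.a (e.dom.i (e.dom.s n.1))) := by
  refine (ψ.bdEquiv_spec _ (R w) (hR w) _).trans ?_
  rw [e.map.a_i, e.map.a_s]
  rfl

theorem compFill_safe (e : BigEmb G.graph) (ψ : GMap G.graph G'.graph)
    (R : e.dom.V → BigEmb G'.graph) (hR : ∀ w, Emb.mk (R w) = ψ.one (e.map.v w)) (x) :
    x ∈ (compFill e ψ R hR).subst.bd ∪ Set.range (compFill e ψ R hR).subst.s := by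
  have hc := (compFill e ψ R hR).subst_connected e.conn fun w => (R w).conn
  rcases hc.safe_or with h | ⟨h1, h2⟩
  · exact h x
  · exfalso
    have hbd : e.dom.bd = ∅ := Set.image_eq_empty.1 h2
    obtain ⟨hs, hG⟩ := U.onto e hbd
    obtain ⟨v, hv⟩ := ψ.collapse hG
    obtain ⟨w, rfl⟩ := hs v
    rw [← hR w, Emb.isEdge_mk, U.isEdge_iff] at hv
    exact hv ⟨fun u => h1.false ⟨w, u⟩⟩

/-- The embedding of a graph substitution obtained by assembling the embeddings `R w` assigned by `ψ`
to the vertices of the domain of `e`. -/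
noncomputable def compEmb (e : BigEmb G.graph) (ψ : GMap G.graph G'.graph)
    (R : e.dom.V → BigEmb G'.graph) (hR : ∀ w, Emb.mk (R w) = ψ.one (e.map.v w)) :
    BigEmb G'.graph where
  dom := (compFill e ψ R hR).subst
  conn := (compFill e ψ R hR).subst_connected e.conn fun w => (R w).conn
  map :=
    { a := (compFill e ψ R hR).arcLift (fun a => ψ.zero (e.map.a a)) (fun w => (R w).map.a)
        (fun w n => (compFill_m e ψ R hR w n).symm)
        (fun w n => by
          refine Eq.trans ?_ ((R w).map.a_i _).symm
          rw [compFill_m, e.map.a_i, ψ.zero_i, MGraph.i_i])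
      d := fun x => (R x.1).map.d x.2
      v := fun x => (R x.1).map.v x.2
      a_i := (compFill e ψ R hR).arc_ind
        (fun a => (congrArg ψ.zero (e.map.a_i a)).trans (ψ.zero_i _))
        (fun w h => (R w).map.a_i h)
      a_s := fun x => (R x.1).map.a_s x.2
      v_t := fun x => (R x.1).map.v_t x.2
      pullback := fun y ⟨w, u⟩ h => by
        obtain ⟨x, ⟨h1, h2⟩, h3⟩ := (R w).map.pullback y u h
        refine ⟨⟨w, x⟩, ⟨h1, congrArg (Sigma.mk w) h2⟩, ?_⟩
        rintro ⟨w', x'⟩ ⟨h4, h5⟩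
        obtain ⟨rfl, h6⟩ := Sigma.mk.inj_iff.1 h5
        exact congrArg (Sigma.mk _) (h3 x' ⟨h4, eq_of_heq h6⟩)
      compl := fun x hx => (hx (compFill_safe e ψ R hR x)).elim }
  inj := by
    rintro ⟨w, u⟩ ⟨w', u'⟩ h
    obtain rfl := e.inj (ψ.disj (hR w) (hR w') h)
    exact congrArg (Sigma.mk w) ((R w).inj h)

theorem compEmb_congr {e e' : BigEmb G.graph} (ψ : GMap G.graph G'.graph)
    {R : e.dom.V → BigEmb G'.graph} {hR : ∀ w, Emb.mk (R w) = ψ.one (e.map.v w)}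
    {R' : e'.dom.V → BigEmb G'.graph} {hR' : ∀ w, Emb.mk (R' w) = ψ.one (e'.map.v w)}
    (h : Emb.mk e = Emb.mk e') : Emb.mk (compEmb e ψ R hR) = Emb.mk (compEmb e' ψ R' hR') := by
  obtain ⟨z, ha, hd, hv⟩ := Emb.mk_eq.1 h
  have hz : ∀ w, (R w).Rel (R' (z.v w)) := fun w =>
    Emb.mk_eq.1 (by rw [hR, hR', hv])
  choose zv hza hzd hzv using hz
  refine Emb.mk_eq.2 (BigEmb.rel_of (Filling.substCongr z zv fun w n => ?_)
    (Filling.arc_ind _ (fun a => congrArg ψ.zero (ha a)) (fun w h => hza w h))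
    (fun x => hzv x.1 x.2))
  refine (R' (z.v w)).injOn_bd (((zv w).a_bd _).2 (Subtype.property _)) (Subtype.property _) ?_
  rw [compFill_m, Iso.nb_coe, ← hza, compFill_m, ha, z.a_i, z.a_s]

/-- The canonical embedding of the star of a vertex. -/
def starEmb (G : MGraph) (v : G.V) : BigEmb G where
  dom := star (G.N v)
  conn := star_connected _
  map :=
    { a := Sum.elim (fun n => G.i (G.s n)) (fun n => G.s n)
      d := fun n => n.1
      v := fun _ => v
      a_i := by
        rintro (n | n)
        · exact (G.i_i _).symm
        · rfl
      a_s := fun _ => rfl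
      v_t := fun n => n.2.symm
      pullback := fun y _ h => ⟨⟨y, h⟩, ⟨rfl, rfl⟩, fun n hn => Subtype.ext hn.1⟩
      compl := by
        rintro (n | n) h
        · exact (h (Or.inl ⟨n, rfl⟩)).elim
        · exact (h (Or.inr ⟨n, rfl⟩)).elim }
  inj := fun _ _ _ => rfl

theorem starEmb_bdry (G : MGraph) (v : G.V) :
    (starEmb G v).bdry = (fun d => G.i (G.s d)) '' {d | G.t d = v} := by
  ext y
  constructor
  · rintro ⟨_, ⟨n, rfl⟩, rfl⟩
    exact ⟨n.1, n.2, rfl⟩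
  · rintro ⟨d, hd, rfl⟩
    exact ⟨Sum.inl ⟨d, hd⟩, ⟨⟨d, hd⟩, rfl⟩, rfl⟩

theorem U.exists_vertex (G : U) (h : G.graph.bd = ∅) : Nonempty G.graph.V := by
  rcases G.conn.1 with ⟨⟨a⟩⟩ | h'
  · obtain ⟨d, _⟩ := (G.mem_or a).resolve_left (by simp [h])
    exact ⟨G.graph.t d⟩
  · exact h'

/-- The identity graphical map. -/
def idMap (G : U) : GMap G.graph G.graph where
  zero := id
  one v := Emb.mk (starEmb G.graph v)
  zero_i _ := rfl
  noDouble := (noDouble_iff _).2 fun _ _ _ _ h => h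
  boundary v := by
    rw [Emb.bdry_mk, starEmb_bdry]
    exact Set.InjOn.bijOn_image fun x _ y _ h => G.graph.s_inj (G.graph.i_inj h)
  collapse h := by
    obtain ⟨v⟩ := G.exists_vertex h
    exact ⟨v, fun h' => ((U.isEdge_iff _).1 h').false ()⟩

/-- Every graph embeds in itself. -/
def idEmb (G : U) : BigEmb G.graph where
  dom := G.graph
  conn := G.conn
  map := ⟨id, id, id, fun _ => rfl, fun _ => rfl, fun _ => rfl,
    fun y _ h => ⟨y, ⟨rfl, h⟩, fun _ h => h.1⟩, fun _ h => h⟩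
  inj := fun _ _ h => h

/-- The composite embedding, formed with chosen representatives. -/
noncomputable def compOne (φ : GMap G.graph G'.graph) (ψ : GMap G'.graph G''.graph)
    (v : G.graph.V) : BigEmb G''.graph :=
  compEmb (φ.one v).rep ψ (fun w => (ψ.one ((φ.one v).rep.map.v w)).rep) (fun _ => Emb.mk_rep _)

theorem mk_compOne (φ : GMap G.graph G'.graph) (ψ : GMap G'.graph G''.graph) (v : G.graph.V)
    (e : BigEmb G'.graph) (he : Emb.mk e = φ.one v) (R : e.dom.V → BigEmb G''.graph)
    (hR : ∀ w, Emb.mk (R w) = ψ.one (e.map.v w)) :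
    Emb.mk (compOne φ ψ v) = Emb.mk (compEmb e ψ R hR) :=
  compEmb_congr ψ ((Emb.mk_rep _).trans he.symm)

theorem compEmb_bdry (e : BigEmb G.graph) (ψ : GMap G.graph G'.graph)
    (R : e.dom.V → BigEmb G'.graph) (hR : ∀ w, Emb.mk (R w) = ψ.one (e.map.v w)) :
    (compEmb e ψ R hR).bdry = ψ.zero '' e.bdry := by
  unfold BigEmb.bdry
  rw [Set.image_image]
  exact Set.image_image _ _ _

/-- Composition of graphical maps: a vertex `v` is sent to the class of the embedding assembled from a
representative `K → G'` of `φ.one v` and representatives of the classes assigned by `ψ` to the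
vertices of `K`. -/
noncomputable def compMap (φ : GMap G.graph G'.graph) (ψ : GMap G'.graph G''.graph) :
    GMap G.graph G''.graph where
  zero := fun a => ψ.zero (φ.zero a)
  one v := Emb.mk (compOne φ ψ v)
  zero_i a := by rw [φ.zero_i, ψ.zero_i]
  noDouble := (noDouble_iff _).2 fun v v' ⟨w, u⟩ ⟨w', u'⟩ h =>
    φ.disj (Emb.mk_rep _) (Emb.mk_rep _)
      (ψ.disj (Emb.mk_rep _) (Emb.mk_rep _) h)
  boundary v := by
    have h1 := φ.boundary v
    rw [← Emb.mk_rep (φ.one v), Emb.bdry_mk] at h1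
    have h2 : (compOne φ ψ v).bdry = ψ.zero '' (φ.one v).rep.bdry := compEmb_bdry _ _ _ _
    rw [Emb.bdry_mk, h2]
    refine Set.BijOn.comp (Set.InjOn.bijOn_image ?_) h1
    rintro _ ⟨a, ha, rfl⟩ _ ⟨b, hb, rfl⟩ h
    congr 1
    exact Filling.aL_bd_inj _ ha hb ((compOne φ ψ v).injOn_bd ⟨a, ha, rfl⟩ ⟨b, hb, rfl⟩ h)
  collapse h := by
    obtain ⟨hs, hG'⟩ := U.onto (compEmb (idEmb G) φ (fun w => (φ.one w).rep) fun _ => Emb.mk_rep _)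
      (Set.image_eq_empty.2 h)
    obtain ⟨v', hv'⟩ := ψ.collapse hG'
    obtain ⟨⟨v, u⟩, rfl⟩ := hs v'
    refine ⟨v, fun hE => hv' ?_⟩
    have h1 := (U.isEdge_iff _).1 hE
    rw [← Emb.mk_rep (ψ.one _), Emb.isEdge_mk, U.isEdge_iff]
    exact ⟨fun x => h1.false ⟨u, x⟩⟩

theorem compMap_one (φ : GMap G.graph G'.graph) (ψ : GMap G'.graph G''.graph) (v : G.graph.V)
    (e : BigEmb G'.graph) (he : Emb.mk e = φ.one v) (R : e.dom.V → BigEmb G''.graph)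
    (hR : ∀ w, Emb.mk (R w) = ψ.one (e.map.v w)) :
    (compMap φ ψ).one v = Emb.mk (compEmb e ψ R hR) := mk_compOne φ ψ v e he R hR

theorem id_compMap (φ : GMap G.graph G'.graph) : compMap (idMap G) φ = φ := by
  refine GMap.ext rfl (funext fun v => ?_)
  rw [compMap_one (idMap G) φ v (starEmb G.graph v) rfl (fun _ => (φ.one v).rep)
    (fun _ => Emb.mk_rep _)]
  refine Eq.trans ?_ (Emb.mk_rep _)
  refine Emb.mk_eq.2 (BigEmb.rel_of (Filling.substIntoStar _ _) ?_ (fun _ => rfl))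
  refine Filling.arc_ind _ ?_ (fun _ _ => rfl)
  rintro (n | n)
  · exact (compFill_m (starEmb G.graph v) φ _ (fun _ => Emb.mk_rep _) () ⟨n, rfl⟩).symm
  · refine Eq.trans ?_ ((φ.one v).rep.map.a_i _).symm
    refine Eq.trans ?_ (congrArg G'.graph.i
      (compFill_m (starEmb G.graph v) φ _ (fun _ => Emb.mk_rep _) () ⟨n, rfl⟩)).symm
    refine Eq.trans ?_ (φ.zero_i _)
    exact congrArg φ.zero (G.graph.i_i _).symm

theorem compMap_id (φ : GMap G.graph G'.graph) : compMap φ (idMap G') = φ := by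
  refine GMap.ext rfl (funext fun v => ?_)
  rw [compMap_one φ (idMap G') v (φ.one v).rep (Emb.mk_rep _) (fun w => starEmb G'.graph _)
    (fun _ => rfl)]
  refine Eq.trans ?_ (Emb.mk_rep _)
  let e := (φ.one v).rep
  let z : Iso (compFill e (idMap G') (fun w => starEmb G'.graph (e.map.v w)) fun _ => rfl).subst
      e.dom :=
    (Filling.substCongr (F := compFill e (idMap G')
        (fun w => starEmb G'.graph (e.map.v w)) fun _ => rfl) (F' := Filling.stars e.dom (fun w => G'.graph.N (e.map.v w)) e.map.nb)
      (Iso.refl _) (fun w => Iso.refl _) (fun w n => by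
        refine (starEmb G'.graph (e.map.v w)).injOn_bd (Subtype.property _)
          (Subtype.property _) ?_
        refine (compFill_m e (idMap G') (fun w => starEmb G'.graph (e.map.v w))
          (fun _ => rfl) w n).trans ?_
        refine (e.map.a_i _).trans (congrArg G'.graph.i ?_)
        exact e.map.a_s _)).trans (Filling.substStar _ _ _)
  refine Emb.mk_eq.2 (BigEmb.rel_of z ?_ (fun _ => rfl))
  refine Filling.arc_ind _ (fun _ => rfl) ?_
  have hd : ∀ w (n : G'.graph.N (e.map.v w)), n.1 = e.map.d ((e.map.nb w).symm n).1 :=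
    fun w n => congrArg Subtype.val ((e.map.nb w).apply_symm_apply n).symm
  rintro w (n | n)
  · refine Eq.trans ?_ (e.map.a_i _).symm
    refine congrArg G'.graph.i (Eq.trans ?_ (e.map.a_s _).symm)
    exact congrArg G'.graph.s (hd w n)
  · refine Eq.trans ?_ (e.map.a_s _).symm
    exact congrArg G'.graph.s (hd w n)

theorem compMap_assoc {G''' : U} (φ : GMap G.graph G'.graph) (ψ : GMap G'.graph G''.graph)
    (χ : GMap G''.graph G'''.graph) :
    compMap (compMap φ ψ) χ = compMap φ (compMap ψ χ) := by
  refine GMap.ext rfl (funext fun v => ?_)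
  have h1 := compMap_one (compMap φ ψ) χ v (compOne φ ψ v) rfl
    (fun x => (χ.one ((compOne φ ψ v).map.v x)).rep) (fun _ => Emb.mk_rep _)
  have h2 := compMap_one φ (compMap ψ χ) v (φ.one v).rep (Emb.mk_rep _)
    (fun w => compOne ψ χ ((φ.one v).rep.map.v w)) (fun _ => rfl)
  rw [h1, h2]
  let e := (φ.one v).rep
  let ρ : e.dom.V → BigEmb G''.graph := fun w => (ψ.one (e.map.v w)).rep
  let F := compFill e ψ ρ fun _ => Emb.mk_rep _
  let E : ∀ w, Filling (F.H w) := fun w =>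
    compFill (ρ w) χ (fun u => (χ.one ((ρ w).map.v u)).rep) fun _ => Emb.mk_rep _
  let z1 := Filling.substCongr (F := compFill (compOne φ ψ v) χ
      (fun x => (χ.one ((compOne φ ψ v).map.v x)).rep) fun _ => Emb.mk_rep _) (F' := F.inner E)
    (Iso.refl _) (fun w => Iso.refl _) (fun x n => by
      obtain ⟨w, u⟩ := x
      obtain ⟨n, rfl⟩ := (F.nbEquiv w u).surjective n
      refine (χ.one ((ρ w).map.v u)).rep.injOn_bd (Subtype.property _) (Subtype.property _) ?_
      refine (compFill_m (compOne φ ψ v) χ _ (fun _ => Emb.mk_rep _) ⟨w, u⟩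
        (F.nbEquiv w u n)).trans ?_
      exact (compFill_m (ρ w) χ _ (fun _ => Emb.mk_rep _) u n).symm)
  let z2 := Filling.substCongr (F := F.outer E) (F' := compFill e (compMap ψ χ)
      (fun w => compOne ψ χ (e.map.v w)) fun _ => rfl)
    (Iso.refl _) (fun w => Iso.refl _) (fun w n => by
      refine (compOne ψ χ (e.map.v w)).injOn_bd (Subtype.property _) (Subtype.property _) ?_
      refine Eq.trans ?_ (compFill_m e (compMap ψ χ) _ (fun _ => rfl) w n).symm
      exact congrArg χ.zero (compFill_m e ψ ρ (fun _ => Emb.mk_rep _) w n))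
  refine Emb.mk_eq.2 (BigEmb.rel_of ((z1.trans (F.substAssoc E)).trans z2) ?_ (fun _ => rfl))
  exact Filling.arc_ind _ (Filling.arc_ind _ (fun _ => rfl) (fun _ _ => rfl)) (fun _ _ => rfl)

end Comp

/-- The graphical category. -/
noncomputable instance : CategoryTheory.Category U where
  Hom G G' := GMap G.graph G'.graph
  id := idMap
  comp := compMap
  id_comp := id_compMap
  comp_id := compMap_id
  assoc := compMap_assoc

end ModOp

namespace ModOp

open MGraph

/-! ## Coloured graphs -/

/-- Involutive sets. Throughout, `Type 1` plays the role of the category of sets (so that the graphs,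
which are built from finite sets in `Type`, form a set). -/
structure InvSet where
  carrier : Type 1
  inv : carrier → carrier
  inv_inv : ∀ c, inv (inv c) = c

/-- Maps of involutive sets. -/
@[ext]
structure InvMap (C D : InvSet) where
  toFun : C.carrier → D.carrier
  map_inv : ∀ c, toFun (C.inv c) = D.inv (toFun c)

def InvMap.id (C : InvSet) : InvMap C C := ⟨fun c => c, fun _ => rfl⟩

def InvMap.comp {C D E : InvSet} (f : InvMap C D) (g : InvMap D E) : InvMap C E :=
  ⟨fun c => g.toFun (f.toFun c), fun c => by rw [f.map_inv, g.map_inv]⟩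

/-- Finite sets over a set of colours. -/
structure Bij (C : InvSet) where
  S : Type
  fin : Finite S
  ξ : S → C.carrier

attribute [instance] Bij.fin

/-- Bijections over the set of colours. -/
@[ext]
structure Bij.Hom {C : InvSet} (X Y : Bij C) where
  e : X.S ≃ Y.S
  comm : ∀ s, Y.ξ (e s) = X.ξ s

instance (C : InvSet) : Category (Bij C) where
  Hom := Bij.Hom
  id X := ⟨Equiv.refl _, fun _ => rfl⟩
  comp f g := ⟨f.e.trans g.e, fun s => by simp [f.comm, g.comm]⟩

theorem Bij.hom_ext {C : InvSet} {X Y : Bij C} {f g : X ⟶ Y} (h : ∀ s, f.e s = g.e s) : f = g :=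
  Bij.Hom.ext (Equiv.ext h)

theorem Bij.comp_e {C : InvSet} {X Y Z : Bij C} (f : X ⟶ Y) (g : Y ⟶ Z) (s) :
    (f ≫ g).e s = g.e (f.e s) := rfl

theorem Bij.id_e {C : InvSet} (X : Bij C) (s) : (𝟙 X : X ⟶ X).e s = s := rfl

variable {C : InvSet}

theorem Bij.map_map (X : Bij C ⥤ Type 1) {S S₁ S₂ S' : Bij C} (f : S ⟶ S₁) (g : S₁ ⟶ S')
    (f' : S ⟶ S₂) (g' : S₂ ⟶ S') (h : ∀ s, g.e (f.e s) = g'.e (f'.e s)) (x : X.obj S) :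
    X.map g (X.map f x) = X.map g' (X.map f' x) := by
  rw [← X.map_comp_apply, ← X.map_comp_apply]
  exact congrArg (fun k => X.map k x) (Bij.hom_ext h)

theorem Bij.map_map_id (X : Bij C ⥤ Type 1) {S S₁ : Bij C} (f : S ⟶ S₁) (g : S₁ ⟶ S)
    (h : ∀ s, g.e (f.e s) = s) (x : X.obj S) : X.map g (X.map f x) = x := by
  rw [← X.map_comp_apply]
  exact (congrArg (fun k => X.map k x) (Bij.hom_ext (g := 𝟙 S) h)).trans (X.map_id_apply _ _)

/-- Connected coloured graphs with boundary identified with the object `X` of `Bij C`, that is, the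
objects of the comma category of `X` over the boundary functor from the groupoid of connected
coloured graphs to `Bij C`. -/
structure CGr (X : Bij C) where
  G : MGraph
  conn : G.Connected
  ζ : G.A → C.carrier
  ζ_i : ∀ a, ζ (G.i a) = C.inv (ζ a)
  f : X.S ≃ G.bd
  ζ_f : ∀ s, ζ (f s).1 = X.ξ s

namespace CGr

/-- Isomorphisms of coloured graphs with identified boundary. -/
structure Iso {X : Bij C} (K K' : CGr X) extends MGraph.Iso K.G K'.G where
  ζ : ∀ x, K'.ζ (a x) = K.ζ x
  f : ∀ s, a (K.f s).1 = (K'.f s).1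

/-- The neighborhood of a vertex, coloured by the arcs pointing away from the vertex. (This is
identified by the involution with the coloured set of arcs `i (nbhd v)`.) -/
def nb {X : Bij C} (K : CGr X) (v : K.G.V) : Bij C :=
  ⟨K.G.N v, inferInstance, fun n => K.ζ (K.G.i (K.G.s n.1))⟩

/-- The effect of an isomorphism on a neighborhood. -/
def Iso.nbHom {X : Bij C} {K K' : CGr X} (z : Iso K K') (v : K.G.V) : K.nb v ⟶ K'.nb (z.v v) :=
  ⟨z.nb v, fun n => by
    change K'.ζ (K'.G.i (K'.G.s (z.d n.1))) = K.ζ (K.G.i (K.G.s n.1))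
    rw [← z.a_s, ← z.a_i, z.ζ]⟩

def Iso.refl {X : Bij C} (K : CGr X) : Iso K K :=
  { MGraph.Iso.refl K.G with ζ := fun _ => rfl, f := fun _ => rfl }

def Iso.trans {X : Bij C} {K K' K'' : CGr X} (z : Iso K K') (w : Iso K' K'') : Iso K K'' :=
  { MGraph.Iso.trans z.toIso w.toIso with
    ζ := fun x => (w.ζ _).trans (z.ζ x)
    f := fun s => (congrArg w.a (z.f s)).trans (w.f s) }

def Iso.symm {X : Bij C} {K K' : CGr X} (z : Iso K K') : Iso K' K :=
  { MGraph.Iso.symm z.toIso with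
    ζ := fun x => by
      have := z.ζ (z.a.symm x)
      rw [Equiv.apply_symm_apply] at this
      exact this.symm
    f := fun s => by
      change z.a.symm _ = _
      rw [← z.f, Equiv.symm_apply_apply] }

/-- Relabelling of the boundary. -/
def push {X Y : Bij C} (l : X ⟶ Y) (K : CGr X) : CGr Y where
  G := K.G
  conn := K.conn
  ζ := K.ζ
  ζ_i := K.ζ_i
  f := l.e.symm.trans K.f
  ζ_f := fun s => (K.ζ_f _).trans (by
    rw [← l.comm, Equiv.apply_symm_apply])

/-- The coloured star. -/
noncomputable def star (X : Bij C) : CGr X where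
  G := MGraph.star X.S
  conn := star_connected _
  ζ := Sum.elim X.ξ fun s => C.inv (X.ξ s)
  ζ_i := by
    rintro (s | s)
    · rfl
    · exact (C.inv_inv _).symm
  f := Equiv.ofInjective (Sum.inl : X.S → X.S ⊕ X.S) Sum.inl_injective
  ζ_f := fun _ => rfl

/-- The neighborhood of the vertex of the star. -/
def starHom (X : Bij C) : X ⟶ (star X).nb () :=
  ⟨⟨fun s => ⟨s, rfl⟩, fun n => n.1, fun _ => rfl, fun _ => rfl⟩, fun _ => rfl⟩

/-- The filling given by coloured graphs with boundary identified with the neighborhoods. -/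
def fill {X : Bij C} (K : CGr X) (L : ∀ v, CGr (K.nb v)) : Filling K.G where
  H v := (L v).G
  m v := (L v).f

/-- Coloured graph substitution. -/
noncomputable def subst {X : Bij C} (K : CGr X) (L : ∀ v, CGr (K.nb v)) : CGr X where
  G := (K.fill L).subst
  conn := (K.fill L).subst_connected K.conn fun v => (L v).conn
  ζ := (K.fill L).arcLift K.ζ (fun v => (L v).ζ) (fun v n => ((L v).ζ_f n).symm)
    (fun v n => by
      refine Eq.trans ?_ ((L v).ζ_i _).symm
      refine Eq.trans ?_ (congrArg C.inv ((L v).ζ_f n)).symm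
      change _ = C.inv (K.ζ (K.G.i (K.G.s n.1)))
      rw [K.ζ_i, C.inv_inv])
  ζ_i := (K.fill L).arc_ind K.ζ_i fun v => (L v).ζ_i
  f := K.f.trans (K.fill L).bdEquiv
  ζ_f := K.ζ_f

/-- Neighborhoods in a graph substitution. -/
def substHom {X : Bij C} (K : CGr X) (L : ∀ v, CGr (K.nb v)) (v : K.G.V) (w : (L v).G.V) :
    (L v).nb w ⟶ (K.subst L).nb ⟨v, w⟩ :=
  ⟨(K.fill L).nbEquiv v w, fun _ => rfl⟩

/-- Change of colours. -/
def recolor {D : InvSet} (g : InvMap C D) {X : Bij C} (K : CGr X) :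
    CGr (C := D) ⟨X.S, X.fin, fun s => g.toFun (X.ξ s)⟩ where
  G := K.G
  conn := K.conn
  ζ := fun a => g.toFun (K.ζ a)
  ζ_i := fun a => by rw [K.ζ_i, g.map_inv]
  f := K.f
  ζ_f := fun s => congrArg g.toFun (K.ζ_f s)

end CGr

/-! ## The free graph monad -/

/-- A coloured graph with boundary identified with `S`, together with a decoration by `X`, that is,
an element of the product over all vertices `v` of the sets `X (nbhd v)`. -/
structure Dec (X : Bij C ⥤ Type 1) (S : Bij C) where
  gr : CGr S
  el : ∀ v, X.obj (gr.nb v)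

namespace Dec

variable {X : Bij C ⥤ Type 1} {S : Bij C}

/-- Two decorated graphs are identified if there is an isomorphism between them which preserves
the decorations. -/
def Rel (p q : Dec X S) : Prop :=
  ∃ z : CGr.Iso p.gr q.gr, ∀ v, X.map (z.nbHom v) (p.el v) = q.el (z.v v)

theorem Rel.refl (p : Dec X S) : p.Rel p :=
  ⟨CGr.Iso.refl _, fun _ => X.map_id_apply _ _⟩

theorem Rel.trans {p q r : Dec X S} (h : p.Rel q) (h' : q.Rel r) : p.Rel r := by
  obtain ⟨z, hz⟩ := h
  obtain ⟨w, hw⟩ := h'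
  refine ⟨z.trans w, fun v => ?_⟩
  refine Eq.trans ?_ (hw _)
  rw [← hz, ← X.map_comp_apply]
  rfl

theorem Rel.symm {p q : Dec X S} (h : p.Rel q) : q.Rel p := by
  obtain ⟨z, hz⟩ := h
  refine ⟨z.symm, fun v' => ?_⟩
  obtain ⟨v, rfl⟩ := z.v.surjective v'
  have key : ∀ u, u = v → ∀ (g : q.gr.nb (z.v v) ⟶ p.gr.nb u)
      (_ : ∀ n, (g.e n).1 = z.d.symm n.1), X.map g (q.el (z.v v)) = p.el u := by
    rintro u rfl g hg
    rw [← hz, ← X.map_comp_apply]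
    have : z.nbHom u ≫ g = 𝟙 _ := Bij.hom_ext fun n =>
      Subtype.ext ((hg _).trans (z.d.symm_apply_apply n.1))
    rw [this, X.map_id_apply]
  exact key _ (z.v.symm_apply_apply v) _ fun _ => rfl

instance setoid (X : Bij C ⥤ Type 1) (S : Bij C) : Setoid (Dec X S) :=
  ⟨Rel, Rel.refl, Rel.symm, Rel.trans⟩

/-- Relabelling of the boundary. -/
def push {S' : Bij C} (l : S ⟶ S') (p : Dec X S) : Dec X S' := ⟨p.gr.push l, p.el⟩

/-- Functoriality in the decorations. -/
def map {Y : Bij C ⥤ Type 1} (α : X ⟶ Y) (p : Dec X S) : Dec Y S := ⟨p.gr, fun v => α.app _ (p.el v)⟩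

/-- A decorated star. -/
noncomputable def star (x : X.obj S) : Dec X S := ⟨CGr.star S, fun _ => X.map (CGr.starHom S) x⟩

/-- Substitution of decorated graphs. -/
noncomputable def subst (K : CGr S) (y : ∀ v, Dec X (K.nb v)) : Dec X S :=
  ⟨K.subst fun v => (y v).gr, fun (x : Σ v, (y v).gr.G.V) =>
    X.map (K.substHom (fun v => (y v).gr) x.1 x.2) ((y x.1).el x.2)⟩

theorem rel_push {S' : Bij C} (l : S ⟶ S') {p q : Dec X S} (h : p.Rel q) :
    (p.push l).Rel (q.push l) := by
  obtain ⟨z, hz⟩ := h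
  exact ⟨{ z with ζ := z.ζ, f := fun s => z.f _ }, hz⟩

theorem rel_map {Y : Bij C ⥤ Type 1} (α : X ⟶ Y) {p q : Dec X S} (h : p.Rel q) :
    (p.map α).Rel (q.map α) := by
  obtain ⟨z, hz⟩ := h
  refine ⟨z, fun v => ?_⟩
  exact (NatTrans.naturality_apply α _ _).symm.trans (congrArg _ (hz v))

theorem rel_subst {K K' : CGr S} (z : CGr.Iso K K') {y : ∀ v, Dec X (K.nb v)}
    {y' : ∀ v, Dec X (K'.nb v)} (h : ∀ v, ((y v).push (z.nbHom v)).Rel (y' (z.v v))) :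
    (subst K y).Rel (subst K' y') := by
  choose zv hzv using h
  let w : MGraph.Iso (subst K y).gr.G (subst K' y').gr.G :=
    Filling.substCongr (F := K.fill fun v => (y v).gr) (F' := K'.fill fun v => (y' v).gr)
      z.toIso (fun v => (zv v).toIso) (fun v n => by
        refine Eq.trans ?_ ((zv v).f (z.nb v n))
        change (zv v).a ((y v).gr.f n).1 = (zv v).a ((y v).gr.f ((z.nb v).symm (z.nb v n))).1
        rw [Equiv.symm_apply_apply])
  refine ⟨⟨w, Filling.arc_ind _ z.ζ fun v => (zv v).ζ,
    fun s => congrArg (Filling.aL (K'.fill fun v => (y' v).gr)) (z.f s)⟩, ?_⟩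
  rintro ⟨v, w⟩
  refine Eq.trans ?_ (congrArg (X.map (K'.substHom (fun v => (y' v).gr) (z.v v) ((zv v).v w)))
    (hzv v w))
  refine Bij.map_map X _ _ _ _ ?_ _
  exact fun _ => rfl

theorem rel_subst' (K : CGr S) {y y' : ∀ v, Dec X (K.nb v)} (h : ∀ v, (y v).Rel (y' v)) :
    (subst K y).Rel (subst K y') :=
  rel_subst (CGr.Iso.refl K) h

end Dec

/-- Isomorphism classes of decorated graphs: the colimit, over the groupoid of coloured graphs with
boundary identified with `S`, of the sets of decorations. -/
def T (X : Bij C ⥤ Type 1) (S : Bij C) : Type 1 := Quotient (Dec.setoid X S)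

namespace T

variable {X Y : Bij C ⥤ Type 1} {S : Bij C}

def mk (p : Dec X S) : T X S := Quotient.mk _ p

theorem mk_eq {p q : Dec X S} : mk p = mk q ↔ p.Rel q := Quotient.eq

noncomputable def rep (t : T X S) : Dec X S := Quotient.out t

theorem mk_rep (t : T X S) : mk t.rep = t := Quotient.out_eq t

theorem ind {P : T X S → Prop} (h : ∀ p, P (mk p)) (t) : P t := Quotient.ind h t

def push {S' : Bij C} (l : S ⟶ S') : T X S → T X S' :=
  Quotient.map (Dec.push l) fun _ _ => Dec.rel_push l

def map (α : X ⟶ Y) : T X S → T Y S := Quotient.map (Dec.map α) fun _ _ => Dec.rel_map α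

end T

/-- The functor of isomorphism classes of decorated graphs. -/
def TObj (X : Bij C ⥤ Type 1) : Bij C ⥤ Type 1 where
  obj := T X
  map l := ↾(T.push l)
  map_id S := by
    ext t
    induction t using T.ind with
    | h p => rfl
  map_comp l l' := by
    ext t
    induction t using T.ind with
    | h p => rfl

/-- The underlying endofunctor of the free graph monad. -/
def TFun (C : InvSet) : (Bij C ⥤ Type 1) ⥤ (Bij C ⥤ Type 1) where
  obj := TObj
  map α :=
    { app := fun S => ↾(T.map α)
      naturality := fun S S' l => by
        ext t
        induction t using T.ind with
        | h p => rfl }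
  map_id X := by
    ext S t
    induction t using T.ind with
    | h p => rfl
  map_comp α β := by
    ext S t
    induction t using T.ind with
    | h p => rfl

theorem TObj_map_mk {X : Bij C ⥤ Type 1} {S S' : Bij C} (l : S ⟶ S') (p : Dec X S) :
    (TObj X).map l (T.mk p) = T.mk (p.push l) := rfl

/-- Substitution of classes of decorated graphs into the vertices of a graph. -/
noncomputable def Dec.join {X : Bij C ⥤ Type 1} {S : Bij C} (p : Dec (TObj X) S) : T X S :=
  T.mk (Dec.subst p.gr fun v => T.rep (p.el v))

theorem Dec.join_eq {X : Bij C ⥤ Type 1} {S : Bij C} (p : Dec (TObj X) S)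
    (y : ∀ v, Dec X (p.gr.nb v)) (hy : ∀ v, T.mk (y v) = p.el v) :
    p.join = T.mk (Dec.subst p.gr y) :=
  T.mk_eq.2 (Dec.rel_subst' _ fun v => T.mk_eq.1 ((T.mk_rep _).trans (hy v).symm))

theorem Dec.join_rel {X : Bij C ⥤ Type 1} {S : Bij C} {p q : Dec (TObj X) S} (h : p.Rel q) :
    p.join = q.join := by
  obtain ⟨z, hz⟩ := h
  refine T.mk_eq.2 (Dec.rel_subst z fun v => T.mk_eq.1 ?_)
  refine Eq.trans ?_ ((hz v).trans (T.mk_rep _).symm)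
  exact congrArg ((TObj X).map (z.nbHom v)) (T.mk_rep (p.el v))

/-- The multiplication of the free graph monad. -/
noncomputable def T.join {X : Bij C ⥤ Type 1} {S : Bij C} : T (TObj X) S → T X S :=
  Quotient.lift Dec.join fun _ _ => Dec.join_rel

theorem T.join_mk {X : Bij C ⥤ Type 1} {S : Bij C} (K : CGr S) (y : ∀ v, Dec X (K.nb v)) :
    T.join (T.mk (⟨K, fun v => T.mk (y v)⟩ : Dec (TObj X) S)) = T.mk (Dec.subst K y) :=
  Dec.join_eq _ _ fun _ => rfl

/-- Every element of `T T X` is a graph decorated by classes of decorated graphs. -/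
theorem T.ind₂ {X : Bij C ⥤ Type 1} {S : Bij C} {P : T (TObj X) S → Prop}
    (h : ∀ (K : CGr S) (y : ∀ v, Dec X (K.nb v)), P (T.mk ⟨K, fun v => T.mk (y v)⟩)) (t) : P t := by
  induction t using T.ind with
  | h p =>
    have h1 : (⟨p.gr, fun v => T.mk (T.rep (p.el v))⟩ : Dec (TObj X) S) = p :=
      congrArg (Dec.mk p.gr) (funext fun v => T.mk_rep (p.el v))
    exact h1 ▸ h p.gr fun v => T.rep (p.el v)

theorem T.map_mk {X Y : Bij C ⥤ Type 1} {S : Bij C} (α : X ⟶ Y) (p : Dec X S) :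
    T.map α (T.mk p) = T.mk (p.map α) := rfl

theorem T.mk_congr {X : Bij C ⥤ Type 1} {S : Bij C} (K : CGr S) {x y : ∀ v, X.obj (K.nb v)}
    (h : ∀ v, x v = y v) : T.mk (⟨K, x⟩ : Dec X S) = T.mk ⟨K, y⟩ :=
  congrArg (fun x => T.mk (Dec.mk K x)) (funext h)

theorem Dec.star_push {X : Bij C ⥤ Type 1} {S S' : Bij C} (l : S ⟶ S') (x : X.obj S) :
    T.mk (Dec.star (X.map l x)) = T.mk ((Dec.star x).push l) := by
  let w : MGraph.Iso (MGraph.star S.S) (MGraph.star S'.S) :=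
    ⟨Equiv.sumCongr l.e l.e, l.e, Equiv.refl _, by rintro (s | s) <;> rfl, fun _ => rfl,
      fun _ => rfl, by
        rintro (s | s)
        · exact iff_of_true ⟨_, rfl⟩ ⟨_, rfl⟩
        · refine iff_of_false ?_ ?_ <;> (rintro ⟨s, hs⟩; cases hs)⟩
  have hζ : ∀ s, (CGr.star S').ζ (w.a s) = (CGr.star S).ζ s := by
    rintro (s | s)
    · exact l.comm s
    · exact congrArg C.inv (l.comm s)
  refine (T.mk_eq.2 (Dec.Rel.symm ⟨⟨w, hζ, fun s => ?_⟩, fun v => ?_⟩))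
  · exact congrArg Sum.inl (l.e.apply_symm_apply s)
  · refine Bij.map_map X _ _ _ _ ?_ _
    exact fun _ => rfl

theorem Dec.subst_star {X : Bij C ⥤ Type 1} {S : Bij C} (p : Dec X S) :
    T.mk (Dec.subst (CGr.star S) fun _ => p.push (CGr.starHom S)) = T.mk p := by
  let F : Filling (CGr.star S).G := (CGr.star S).fill fun _ => p.gr.push (CGr.starHom S)
  refine T.mk_eq.2 ⟨⟨Filling.substIntoStar S.S F, Filling.arc_ind _ ?_ (fun _ _ => rfl), ?_⟩, ?_⟩
  · rintro (s | s)
    · exact p.gr.ζ_f s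
    · exact (p.gr.ζ_i _).trans (congrArg C.inv (p.gr.ζ_f s))
  · exact fun _ => rfl
  · rintro ⟨_, w⟩
    exact Bij.map_map_id X ((CGr.star S).substHom (fun _ => p.gr.push (CGr.starHom S)) () w)
      _ (fun _ => rfl) (p.el w)

theorem Dec.subst_stars {X : Bij C ⥤ Type 1} {S : Bij C} (p : Dec X S) :
    T.mk (Dec.subst p.gr fun v => Dec.star (p.el v)) = T.mk p := by
  refine T.mk_eq.2 ⟨⟨Filling.substStar p.gr.G (fun v => p.gr.G.N v) (fun v => Equiv.refl _),
    Filling.arc_ind _ (fun _ => rfl) ?_, fun _ => rfl⟩, ?_⟩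
  · rintro v (n | n)
    · rfl
    · change p.gr.ζ (p.gr.G.s n.1) = C.inv (p.gr.ζ (p.gr.G.i (p.gr.G.s n.1)))
      rw [p.gr.ζ_i, C.inv_inv]
  · rintro ⟨v, _⟩
    refine Eq.trans (congrArg (X.map _) (X.map_comp_apply (CGr.starHom (p.gr.nb v))
      (p.gr.substHom (fun v => CGr.star (p.gr.nb v)) v ()) (p.el v)).symm) ?_
    exact Bij.map_map_id X _ _ (fun _ => rfl) (p.el v)

theorem Dec.subst_assoc {X : Bij C ⥤ Type 1} {S : Bij C} (K : CGr S) (L : ∀ v, CGr (K.nb v))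
    (y : ∀ v w, Dec X ((L v).nb w)) :
    T.mk (Dec.subst (K.subst L) fun (x : Σ v, (L v).G.V) =>
      (y x.1 x.2).push (K.substHom L x.1 x.2)) =
    T.mk (Dec.subst K fun v => Dec.subst (L v) (y v)) := by
  refine T.mk_eq.2 ⟨⟨(K.fill L).substAssoc (fun v => (L v).fill fun w => (y v w).gr),
    Filling.arc_ind _ (Filling.arc_ind _ (fun _ => rfl) (fun _ _ => rfl)) (fun _ _ => rfl),
    fun _ => rfl⟩, ?_⟩
  rintro ⟨⟨v, w⟩, u⟩
  refine Bij.map_map X _ _ _ _ ?_ ((y v w).el u)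
  exact fun _ => rfl

/-- The free graph monad. -/
noncomputable def freeGraphMonad (C : InvSet) : Monad (Bij C ⥤ Type 1) where
  toFunctor := TFun C
  η :=
    { app := fun X =>
        { app := fun S => ↾fun x => T.mk (Dec.star x)
          naturality := fun S S' l => by
            ext x
            exact Dec.star_push l x }
      naturality := fun X Y α => by
        ext S x
        exact T.mk_congr (CGr.star S) fun _ => (NatTrans.naturality_apply α _ x).symm }
  μ :=
    { app := fun X =>
        { app := fun S => ↾T.join
          naturality := fun S S' l => by
            ext t
            induction t using T.ind₂ with
            | h K y =>
              refine (T.join_mk (K.push l) y).trans ?_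
              exact (congrArg ((TObj X).map l) (T.join_mk K y)).symm }
      naturality := fun X Y α => by
        ext S t
        induction t using T.ind₂ with
        | h K y =>
          refine (T.join_mk K fun v => (y v).map α).trans ?_
          refine Eq.trans ?_ (congrArg (T.map α) (T.join_mk K y)).symm
          exact T.mk_congr (K.subst fun v => (y v).gr) fun _ => (NatTrans.naturality_apply α _ _).symm }
  assoc X := by
    ext S t
    induction t using T.ind₂ with
    | h K y =>
      obtain ⟨L, y, rfl⟩ : ∃ (L : ∀ v, CGr (K.nb v)) (z : ∀ v w, Dec X ((L v).nb w)),
          y = fun v => (⟨L v, fun w => T.mk (z v w)⟩ : Dec (TObj X) (K.nb v)) :=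
        ⟨fun v => (y v).gr, fun v w => T.rep ((y v).el w), funext fun v =>
          congrArg (Dec.mk (y v).gr) (funext fun w => (T.mk_rep ((y v).el w)).symm)⟩
      have h1 := T.join_mk K fun v => Dec.subst (L v) (y v)
      have h2 : T.mk (⟨K, fun v => T.mk (Dec.subst (L v) (y v))⟩ : Dec (TObj X) S) =
          T.mk ⟨K, fun v => T.join (T.mk ⟨L v, fun w => T.mk (y v w)⟩)⟩ :=
        T.mk_congr K fun v => (T.join_mk (L v) (y v)).symm
      have h3 := T.join_mk K fun v => (⟨L v, fun w => T.mk (y v w)⟩ : Dec (TObj X) (K.nb v))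
      have h4 := T.join_mk (K.subst L) fun (x : Σ v, (L v).G.V) =>
        (y x.1 x.2).push (K.substHom L x.1 x.2)
      exact (congrArg T.join h2.symm).trans (h1.trans ((Dec.subst_assoc K L y).symm.trans
        (h4.symm.trans (congrArg T.join h3.symm))))
  left_unit X := by
    ext S t
    induction t using T.ind with
    | h p => exact (T.join_mk (CGr.star S) fun _ => p.push (CGr.starHom S)).trans p.subst_star
  right_unit X := by
    ext S t
    induction t using T.ind with
    | h p => exact (T.join_mk p.gr fun v => Dec.star (p.el v)).trans p.subst_stars

end ModOp

namespace ModOp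

open MGraph

/-! ## Modular operads -/

/-- The functor on finite sets over colours induced by a map of colours. -/
def Bij.recolor {C D : InvSet} (g : InvMap C D) : Bij C ⥤ Bij D where
  obj X := ⟨X.S, X.fin, fun s => g.toFun (X.ξ s)⟩
  map l := ⟨l.e, fun s => congrArg g.toFun (l.comm s)⟩

section Recolor

variable {C D : InvSet} (g : InvMap C D) {Y : Bij D ⥤ Type 1} {S : Bij C}

/-- Change of colours of a decorated graph. -/
def Dec.recolor (p : Dec (Bij.recolor g ⋙ Y) S) : Dec Y ((Bij.recolor g).obj S) :=
  ⟨p.gr.recolor g, p.el⟩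

theorem Dec.rel_recolor {p q : Dec (Bij.recolor g ⋙ Y) S} (h : p.Rel q) :
    (p.recolor g).Rel (q.recolor g) := by
  obtain ⟨z, hz⟩ := h
  exact ⟨⟨z.toIso, fun x => congrArg g.toFun (z.ζ x), z.f⟩, hz⟩

def T.recolor : T (Bij.recolor g ⋙ Y) S → T Y ((Bij.recolor g).obj S) :=
  Quotient.map (Dec.recolor g) fun _ _ => Dec.rel_recolor g

theorem T.recolor_mk (p : Dec (Bij.recolor g ⋙ Y) S) :
    T.recolor g (T.mk p) = T.mk (p.recolor g) := rfl

end Recolor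

/-- The comparison of the free graph functors for two sets of colours. -/
def recolorNat {C D : InvSet} (g : InvMap C D) (Y : Bij D ⥤ Type 1) :
    (freeGraphMonad C).obj (Bij.recolor g ⋙ Y) ⟶ Bij.recolor g ⋙ (freeGraphMonad D).obj Y where
  app S := ↾(T.recolor g)
  naturality S S' l := by
    ext t
    induction t using T.ind with
    | h p => rfl

/-- The pullback `g^* Q` of a modular operad along a map of colours, with
`(g^* Q) (S, ξ) = Q (S, g ∘ ξ)`. -/
noncomputable def pullAlg {C D : InvSet} (g : InvMap C D) (Q : (freeGraphMonad D).Algebra) :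
    (freeGraphMonad C).Algebra where
  A := Bij.recolor g ⋙ Q.A
  a := recolorNat g Q.A ≫ Functor.whiskerLeft (Bij.recolor g) Q.a
  unit := by
    ext S x
    have h : T.recolor g (T.mk (Dec.star (X := Bij.recolor g ⋙ Q.A) x)) =
        T.mk (Dec.star (X := Q.A) (S := (Bij.recolor g).obj S) x) := by
      refine T.mk_eq.2 ⟨⟨MGraph.Iso.refl _, ?_, fun _ => rfl⟩, fun v => Q.A.map_id_apply _ _⟩
      rintro (s | s)
      · rfl
      · exact (g.map_inv _).symm
    exact (congrArg (Q.a.app _) h).trans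
      (ConcreteCategory.congr_hom (NatTrans.congr_app Q.unit ((Bij.recolor g).obj S)) x)
  assoc := by
    ext S t
    induction t using T.ind₂ with
    | h K y =>
      have h : T.recolor g (T.mk (Dec.subst K y)) =
          T.mk (Dec.subst (K.recolor g) fun v => (y v).recolor g) := by
        refine T.mk_eq.2 ⟨⟨MGraph.Iso.refl _, ?_, fun _ => rfl⟩, fun v => Q.A.map_id_apply _ _⟩
        exact Filling.arc_ind _ (fun _ => rfl) (fun _ _ => rfl)
      have h1 := congrArg (Q.a.app _) (congrArg (T.recolor g) (T.join_mk K y))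
      have h2 := congrArg (Q.a.app _) (T.join_mk (K.recolor g) fun v => (y v).recolor g)
      have h3 := ConcreteCategory.congr_hom (NatTrans.congr_app Q.assoc ((Bij.recolor g).obj S))
        (T.mk ⟨K.recolor g, fun v => T.mk ((y v).recolor g)⟩)
      exact (h1.trans (congrArg (Q.a.app _) h)).trans (h2.symm.trans h3)

/-- A modular operad: an involutive set of colours and an algebra over the free graph monad. -/
structure CSM where
  colors : InvSet
  alg : (freeGraphMonad colors).Algebra

/-- A morphism of modular operads: a map of involutive sets of colours `f`, and a morphism of
algebras to the pullback along `f`. -/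
structure CSM.Hom (P Q : CSM) where
  base : InvMap P.colors Q.colors
  fib : P.alg ⟶ pullAlg base Q.alg

noncomputable def CSM.Hom.id (P : CSM) : CSM.Hom P P where
  base := InvMap.id _
  fib :=
    { f := 𝟙 P.alg.A
      h := by
        ext S t
        induction t using T.ind with
        | h p => rfl }

noncomputable def CSM.Hom.comp {P Q R : CSM} (f : CSM.Hom P Q) (g : CSM.Hom Q R) : CSM.Hom P R where
  base := f.base.comp g.base
  fib :=
    { f := f.fib.f ≫ Functor.whiskerLeft (Bij.recolor f.base) g.fib.f
      h := by
        ext S t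
        induction t using T.ind with
        | h p =>
          have h1 := ConcreteCategory.congr_hom (NatTrans.congr_app f.fib.h S) (T.mk p)
          have h2 := ConcreteCategory.congr_hom
            (NatTrans.congr_app g.fib.h ((Bij.recolor f.base).obj S))
            (T.mk ((p.map f.fib.f).recolor f.base))
          exact h2.trans (congrArg (g.fib.f.app _) h1) }

/-- The category of modular operads, that is, the Grothendieck construction of the categories of
algebras over the free graph monads. -/
noncomputable instance : Category CSM where
  Hom := CSM.Hom
  id := CSM.Hom.id
  comp := CSM.Hom.comp
  id_comp _ := rfl
  comp_id _ := rfl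
  assoc _ _ _ := rfl

/-! ## The modular operad generated by a graph -/

/-- The involutive set of arcs of a graph. -/
def arcs (G : MGraph) : InvSet where
  carrier := ULift G.A
  inv a := ⟨G.i a.down⟩
  inv_inv a := congrArg ULift.up (G.i_i a.down)

/-- The generators: `v` is a generator over `ξ : S → A` if `ξ` is injective with image the set
`i (nbhd v)` of arcs pointing away from `v`. -/
def gens (G : MGraph) : Bij (arcs G) ⥤ Type 1 where
  obj X := ULift {v : G.V // Function.Injective X.ξ ∧
    Set.range X.ξ = {a | ∃ d, G.t d = v ∧ a.down = G.i (G.s d)}}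
  map {X Y} l := ↾fun x => ⟨⟨x.down.1, by
    have h : Y.ξ = X.ξ ∘ l.e.symm := funext fun s => by
      rw [Function.comp_apply, ← l.comm, Equiv.apply_symm_apply]
    rw [h]
    exact ⟨x.down.2.1.comp l.e.symm.injective, by
      rw [Set.range_comp, l.e.symm.range_eq_univ, Set.image_univ]; exact x.down.2.2⟩⟩⟩

/-- The modular operad generated by a graph. -/
noncomputable def genOperad (G : MGraph) : CSM := ⟨arcs G, (freeGraphMonad (arcs G)).free.obj (gens G)⟩

/-- The set of arcs pointing away from the vertex `v`, as a set over the colours of `genOperad G`,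
indexed by the neighborhood of `v` through the involution. -/
def outArcs (G : MGraph) (v : G.V) : Bij (arcs G) := ⟨G.N v, inferInstance, fun n => ⟨G.i (G.s n.1)⟩⟩

/-- The index set of a generator is identified with the arcs pointing away from its vertex. -/
theorem exists_outArcs_hom (G : MGraph) {X : Bij (arcs G)} (x : (gens G).obj X) :
    Nonempty (outArcs G x.down.1 ⟶ X) := by
  obtain ⟨v, hinj, hr⟩ := x
  have h : ∀ n : G.N v, ∃ s, X.ξ s = ⟨G.i (G.s n.1)⟩ := fun n => by
    have : (⟨G.i (G.s n.1)⟩ : ULift G.A) ∈ Set.range X.ξ := by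
      rw [hr]
      exact ⟨n.1, n.2, rfl⟩
    exact this
  choose e he using h
  refine ⟨⟨Equiv.ofBijective e ⟨fun n k hnk => ?_, fun s => ?_⟩, fun n => he n⟩⟩
  · have h1 := (he n).symm.trans ((congrArg X.ξ hnk).trans (he k))
    exact Subtype.ext (G.s_inj (G.i_inj (ULift.up_injective h1)))
  · have h1 : X.ξ s ∈ {a : (arcs G).carrier | ∃ d, G.t d = v ∧ a.down = G.i (G.s d)} :=
      hr ▸ ⟨s, rfl⟩
    obtain ⟨d, hd, h2⟩ := h1
    exact ⟨⟨d, hd⟩, hinj ((he ⟨d, hd⟩).trans (ULift.down_injective h2.symm))⟩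

/-- The map out of the generators determined by an involutive map of colours, and an operation
for each vertex. -/
noncomputable def gensMap (G : MGraph) {C : InvSet} (Y : Bij C ⥤ Type 1) (f₀ : InvMap (arcs G) C)
    (f₁ : ∀ v, Y.obj ((Bij.recolor f₀).obj (outArcs G v))) : gens G ⟶ Bij.recolor f₀ ⋙ Y where
  app X := ↾fun x => Y.map ((Bij.recolor f₀).map (exists_outArcs_hom G x).some) (f₁ x.down.1)
  naturality X X' l := by
    ext x
    refine Eq.trans ?_ (Y.map_comp_apply _ _ _)
    refine congrArg (fun k => Y.map k (f₁ x.down.1)) ?_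
    rw [← Functor.map_comp]
    refine congrArg (Bij.recolor f₀).map (Bij.hom_ext fun n => ?_)
    refine ((gens G).map l x).down.2.1 ?_
    exact (Bij.Hom.comm (exists_outArcs_hom G ((gens G).map l x)).some n).trans
      (Bij.Hom.comm ((exists_outArcs_hom G x).some ≫ l) n).symm

/-- The morphism out of the modular operad generated by a graph, determined by an involutive map
of colours and an operation for each vertex. -/
noncomputable def genOperadDesc (G : MGraph) (P : CSM) (f₀ : InvMap (arcs G) P.colors)
    (f₁ : ∀ v, P.alg.A.obj ((Bij.recolor f₀).obj (outArcs G v))) : genOperad G ⟶ P where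
  base := f₀
  fib := ((freeGraphMonad (arcs G)).adj.homEquiv (gens G) (pullAlg f₀ P.alg)).symm
    (gensMap G P.alg.A f₀ f₁)

/-- The map of colours induced by a graphical map. -/
def MGraph.GMap.colors {G G' : MGraph} (φ : GMap G G') : InvMap (arcs G) (arcs G') :=
  ⟨fun a => ⟨φ.zero a.down⟩, fun a => congrArg ULift.up (φ.zero_i a.down)⟩

/-- An embedding into `G'`, regarded as a decorated graph: the domain of the embedding, with arcs
coloured by arcs of `G'` and vertices decorated by vertices of `G'`. Here the embedding `r`
represents the class assigned by the graphical map `φ` to the vertex `v`, and the boundary of the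
domain is identified with the arcs pointing away from `v`. -/
noncomputable def embDec {G G' : MGraph} (φ : GMap G G') (v : G.V) (r : BigEmb G')
    (hr : Emb.mk r = φ.one v) :
    Dec (gens G') ((Bij.recolor φ.colors).obj (outArcs G v)) where
  gr :=
    { G := r.dom
      conn := r.conn
      ζ := fun a => ⟨r.map.a a⟩
      ζ_i := fun a => congrArg ULift.up (r.map.a_i a)
      f := φ.bdEquiv v r hr
      ζ_f := fun n => congrArg ULift.up (φ.bdEquiv_spec v r hr n) }
  el w := ⟨⟨r.map.v w, by
    have h : ∀ n : r.dom.N w, r.map.a (r.dom.i (r.dom.s n.1)) =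
        G'.i (G'.s (r.map.nb w n).1) := fun n => by
      rw [r.map.a_i, r.map.a_s]; rfl
    constructor
    · intro n k hnk
      have h1 := (h n).symm.trans ((ULift.up_injective hnk).trans (h k))
      exact (r.map.nb w).injective (Subtype.ext (G'.s_inj (G'.i_inj h1)))
    · ext a
      constructor
      · rintro ⟨n, rfl⟩
        exact ⟨_, (r.map.nb w n).2, h n⟩
      · rintro ⟨d, hd, ha⟩
        obtain ⟨n, hn⟩ := (r.map.nb w).surjective ⟨d, hd⟩
        refine ⟨n, ULift.down_injective ((h n).trans ?_)⟩
        rw [hn, ha]⟩⟩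

/-- The class of the decorated graph does not depend on the embedding representing its class. -/
theorem mk_embDec_eq {G G' : MGraph} (φ : GMap G G') (v : G.V) {r r' : BigEmb G'}
    (hr : Emb.mk r = φ.one v) (hr' : Emb.mk r' = φ.one v) :
    T.mk (embDec φ v r hr) = T.mk (embDec φ v r' hr') := by
  obtain ⟨z, ha, _, hv⟩ := Emb.mk_eq.1 (hr.trans hr'.symm)
  refine T.mk_eq.2 ⟨⟨z, fun x => congrArg ULift.up (ha x).symm, fun n => ?_⟩, fun w => ?_⟩
  · refine r'.injOn_bd ((z.a_bd _).2 (Subtype.property _)) (Subtype.property _) ?_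
    rw [← ha]
    exact (φ.bdEquiv_spec v r hr n).trans (φ.bdEquiv_spec v r' hr' n).symm
  · exact congrArg ULift.up (Subtype.ext (hv w))

/-! ## The assignment on graphs and graphical maps -/

/-- The modular operad generated by an object of the graphical category. -/
noncomputable def JObj (G : U) : CSM := genOperad G.graph

/-- The morphism of modular operads induced by a graphical map: it is given on colours by the map on
arcs, and it sends the generator `v` to the class of embeddings assigned to `v`. -/
noncomputable def JMap {G G' : U} (φ : G ⟶ G') : JObj G ⟶ JObj G' :=
  genOperadDesc G.graph (genOperad G'.graph) (GMap.colors φ) fun v =>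
    T.mk (embDec φ v (Emb.rep (GMap.one φ v)) (Emb.mk_rep _))

/-- The functor given by these assignments, once they are known to be functorial. -/
noncomputable def J (h_id : ∀ G : U, JMap (𝟙 G) = 𝟙 (JObj G))
    (h_comp : ∀ (G G' G'' : U) (φ : G ⟶ G') (ψ : G' ⟶ G''), JMap (φ ≫ ψ) = JMap φ ≫ JMap ψ) :
    U ⥤ CSM where
  obj := JObj
  map := JMap
  map_id := h_id
  map_comp := fun φ ψ => h_comp _ _ _ φ ψ

end ModOp

/-!
A morphism out of the free modular operad on the vertices of `G` is determined by its effect on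
colours and its values on the generators `gen G v` (`CSM.Hom.ext_gen`), and on a general decorated
graph it is computed by graph substitution (`CSM.Hom.app_mk_subst`). So functoriality is checked on
generators. There the identity says that the star of a vertex represents the generator
(`mk_embDec_starEmb`), and compatibility with composition holds because the composite of graphical
maps is itself defined by graph substitution (`JMap_comp`).

Faithfulness: the colours of `JMap φ` recover `φ` on arcs. An isomorphism between the decorated
graphs which represent the values at a generator preserves the colours of the arcs and the
decorations of the vertices. These are the two components of the embedding, so this is an isomorphism
over the target, and the two classes of embeddings agree (`JMap_injective`).

Isomorphisms: let `F` have inverse `F'`, and let the decorated graph `K` represent the value of `F`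
at a generator. Substituting into the vertices `u` of `K` the graphs `H u` representing the values
of `F'` at their decorations gives a star. Substitution into a graph without vertices has no
vertices, so `K` and, by symmetry, all the `H u` have a vertex. The star has only one, hence so do
`K` and its single `H u`. Counting arcs excludes loops: the arcs entering `u` correspond to the
boundary of `H u`, of which there are at most as many as arcs entering the vertex of `H u`, that is,
as boundary arcs of the star, or of `K`. Thus `K` is a star, and `F` sends generators to generators
(`exists_onGen_eq_star`). Hence `F` comes from a graphical map which sends every vertex to the star
of a vertex (`exists_JMap_eq`), as does `F'`, and these two maps are mutually inverse by
faithfulness.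
-/

namespace ModOp

open MGraph

/-! ### Morphisms out of the operad generated by a graph -/

/-- The vertex `v`, as a generator over the arcs pointing away from it. -/
def gen (G : MGraph) (v : G.V) : (gens G).obj (outArcs G v) :=
  ⟨⟨v, fun _ _ h => Subtype.ext (G.s_inj (G.i_inj (ULift.up_injective h))), by
    ext a
    constructor
    · rintro ⟨n, rfl⟩
      exact ⟨n.1, n.2, rfl⟩
    · rintro ⟨d, hd, h⟩
      exact ⟨⟨d, hd⟩, ULift.down_injective h.symm⟩⟩⟩

theorem gens_ext {G : MGraph} {S : Bij (arcs G)} {x y : (gens G).obj S}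
    (h : x.down.1 = y.down.1) : x = y :=
  ULift.down_injective (Subtype.ext h)

/-- Every generator is a relabelling of some `gen G v`. -/
theorem exists_map_gen {G : MGraph} {S : Bij (arcs G)} (x : (gens G).obj S) :
    ∃ l : outArcs G x.down.1 ⟶ S, (gens G).map l (gen G x.down.1) = x := by
  obtain ⟨l⟩ := exists_outArcs_hom G x
  exact ⟨l, gens_ext rfl⟩

namespace CSM.Hom

variable {G : MGraph} {P : CSM}

/-- The value of a morphism out of the operad generated by a graph at a generator. -/
noncomputable def onGen (F : CSM.Hom (genOperad G) P) {S : Bij (arcs G)} (x : (gens G).obj S) :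
    P.alg.A.obj ((Bij.recolor F.base).obj S) :=
  F.fib.f.app S (T.mk (Dec.star x))

theorem onGen_map (F : CSM.Hom (genOperad G) P) {S S' : Bij (arcs G)} (l : S ⟶ S')
    (x : (gens G).obj S) :
    F.onGen ((gens G).map l x) = P.alg.A.map ((Bij.recolor F.base).map l) (F.onGen x) := by
  unfold onGen
  rw [Dec.star_push]
  exact NatTrans.naturality_apply F.fib.f l (T.mk (Dec.star x))

/-- A morphism is computed on a decorated graph by applying it to the decorations, and then composing
the resulting decorated graph in the target. -/
theorem app_mk (F : CSM.Hom (genOperad G) P) {S : Bij (arcs G)} (p : Dec (gens G) S) :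
    F.fib.f.app S (T.mk p) = P.alg.a.app ((Bij.recolor F.base).obj S)
      (T.mk ⟨p.gr.recolor F.base, fun v => F.onGen (p.el v)⟩) := by
  have h := ConcreteCategory.congr_hom (NatTrans.congr_app F.fib.h S)
    (T.mk ⟨p.gr, fun v => T.mk (Dec.star (p.el v))⟩)
  have h2 := (T.join_mk p.gr fun v => Dec.star (p.el v)).trans p.subst_stars
  exact (congrArg (F.fib.f.app S) h2.symm).trans h.symm

/-- For a target of the form `genOperad G'`, the composite is graph substitution. -/
theorem app_mk_subst {G' : MGraph} (F : CSM.Hom (genOperad G) (genOperad G'))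
    {S : Bij (arcs G)} (p : Dec (gens G) S)
    (y : ∀ v, Dec (gens G') ((Bij.recolor F.base).obj (p.gr.nb v)))
    (hy : ∀ v, T.mk (y v) = F.onGen (p.el v)) :
    F.fib.f.app S (T.mk p) =
      T.mk (Dec.subst (S := (Bij.recolor F.base).obj S) (p.gr.recolor F.base) y) := by
  refine (F.app_mk p).trans ?_
  refine Eq.trans ?_ (T.join_mk (S := (Bij.recolor F.base).obj S) (p.gr.recolor F.base) y)
  exact congrArg (T.join (X := gens G') (S := (Bij.recolor F.base).obj S))
    (T.mk_congr (X := TObj (gens G')) (S := (Bij.recolor F.base).obj S) (p.gr.recolor F.base)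
      fun v => (hy v).symm)

/-- A morphism out of the operad generated by a graph is determined by its values on colours and on
the vertices. -/
theorem ext_gen {F F' : CSM.Hom (genOperad G) P} (hb : F.base = F'.base)
    (h : ∀ v, HEq (F.onGen (gen G v)) (F'.onGen (gen G v))) : F = F' := by
  obtain ⟨b, F⟩ := F
  obtain ⟨b', F'⟩ := F'
  obtain rfl : b = b' := hb
  refine congrArg (CSM.Hom.mk b) (Monad.Algebra.Hom.ext ?_)
  have hg : ∀ {S : Bij (arcs G)} (x : (gens G).obj S),
      (CSM.Hom.mk b F).onGen x = (CSM.Hom.mk b F').onGen x := fun {S} x => by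
    obtain ⟨l, hl⟩ := exists_map_gen x
    rw [← hl, onGen_map, onGen_map, eq_of_heq (h _)]
  ext S t
  induction t using T.ind with
  | h p =>
    refine ((CSM.Hom.mk b F).app_mk p).trans (Eq.trans ?_ ((CSM.Hom.mk b F').app_mk p).symm)
    exact congrArg (P.alg.a.app ((Bij.recolor b).obj S))
      (T.mk_congr (S := (Bij.recolor b).obj S) (p.gr.recolor b) fun v => hg (p.el v))

end CSM.Hom

theorem genOperadDesc_onGen (G : MGraph) (P : CSM) (f₀ : InvMap (arcs G) P.colors)
    (f₁ : ∀ v, P.alg.A.obj ((Bij.recolor f₀).obj (outArcs G v))) (v : G.V) :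
    CSM.Hom.onGen (genOperadDesc G P f₀ f₁) (gen G v) = f₁ v := by
  have h := ((freeGraphMonad (arcs G)).adj.homEquiv (gens G) (pullAlg f₀ P.alg)).apply_symm_apply
    (gensMap G P.alg.A f₀ f₁)
  rw [Adjunction.homEquiv_unit] at h
  have h1 := ConcreteCategory.congr_hom (NatTrans.congr_app h (outArcs G v)) (gen G v)
  have h2 : (exists_outArcs_hom G (gen G v)).some = 𝟙 (outArcs G v) :=
    Bij.hom_ext fun n => (gen G v).down.2.1 ((exists_outArcs_hom G (gen G v)).some.comm n)
  have h3 : P.alg.A.map ((Bij.recolor f₀).map (exists_outArcs_hom G (gen G v)).some) (f₁ v) =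
      f₁ v :=
    (congrArg (fun k => P.alg.A.map ((Bij.recolor f₀).map k) (f₁ v)) h2).trans
      (P.alg.A.map_id_apply ((Bij.recolor f₀).obj (outArcs G v)) (f₁ v))
  refine Eq.trans ?_ (h1.trans h3)
  rw [Monad.adj_unit]
  rfl

theorem JMap_onGen {G G' : U} (φ : G ⟶ G') (v : G.graph.V) (r : BigEmb G'.graph)
    (hr : Emb.mk r = GMap.one φ v) :
    CSM.Hom.onGen (JMap φ) (gen G.graph v) = T.mk (embDec φ v r hr) :=
  (genOperadDesc_onGen _ _ _ _ _).trans (mk_embDec_eq φ v _ hr)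

/-! ### Connected graphs and stars -/

theorem MGraph.Connected.mem_bd_or {G : MGraph} (hG : G.Connected) (u : G.V) (a : G.A) :
    a ∈ G.bd ∨ a ∈ Set.range G.s :=
  (hG.safe_or.resolve_right fun h => h.1.false u) a

/-- In a connected graph with a vertex, every boundary arc points away from a vertex. -/
theorem MGraph.Connected.i_mem_range_s {G : MGraph} (hG : G.Connected) (u : G.V) {a : G.A}
    (ha : a ∈ G.bd) : G.i a ∈ Set.range G.s := by
  by_contra hi
  have has : a ∉ Set.range G.s := G.bd_sub ha
  rcases hG.2 (fun b => b = a ∨ b = G.i a) (fun _ => False) (fun b => by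
      constructor
      · rintro (h | h)
        · exact Or.inr (by rw [← h, G.i_i])
        · exact Or.inl (G.i_inj h)
      · rintro (rfl | rfl)
        · exact Or.inr rfl
        · exact Or.inl (G.i_i _)) (fun d => by
      refine iff_of_false ?_ id
      rintro (h | h)
      · exact has ⟨d, h⟩
      · exact hi ⟨d, h⟩) with ⟨_, h⟩ | ⟨h, _⟩
  · exact h u
  · exact h a (Or.inl rfl)

/-- In a connected graph, a vertex is determined by the set of its incoming arcs: a vertex without
incoming arcs is the only vertex. -/
theorem MGraph.Connected.vertex_ext {G : MGraph} (hG : G.Connected) {v v' : G.V}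
    (h : ∀ d, G.t d = v ↔ G.t d = v') : v = v' := by
  by_cases hv : ∃ d, G.t d = v
  · obtain ⟨d, hd⟩ := hv
    exact hd.symm.trans ((h d).1 hd)
  · rcases hG.2 (fun _ => False) (fun w => w = v) (fun _ => Iff.rfl)
      (fun d => iff_of_false id fun hd => hv ⟨d, hd⟩) with ⟨_, h2⟩ | ⟨_, h2⟩
    · exact (h2 v').symm
    · exact (h2 v rfl).elim

/-- A decorated graph with a single vertex and without loops is a decorated star. -/
theorem Dec.mk_eq_star {C : InvSet} {X : Bij C ⥤ Type 1} {S : Bij C} (p : Dec X S) (u : p.gr.G.V)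
    (hu : ∀ u', u' = u) (hbd : ∀ d, p.gr.G.i (p.gr.G.s d) ∈ p.gr.G.bd) :
    ∃ l : p.gr.nb u ⟶ S, T.mk p = T.mk (Dec.star (X.map l (p.el u))) := by
  obtain ⟨⟨K, conn, ζ, ζ_i, f, ζ_f⟩, el⟩ := p
  dsimp only at u hu hbd el
  have hq : ∀ s : S.S, ∃ d, K.s d = K.i (f s).1 := fun s => conn.i_mem_range_s u (f s).2
  choose q hq using hq
  have hq' : ∀ s, K.i (K.s (q s)) = (f s).1 := fun s => by rw [hq, K.i_i]
  have hqb : Function.Bijective q := by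
    constructor
    · intro s s' h
      refine f.injective (Subtype.ext ?_)
      rw [← hq', ← hq', h]
    · intro d
      refine ⟨f.symm ⟨_, hbd d⟩, K.s_inj ?_⟩
      rw [hq, Equiv.apply_symm_apply, K.i_i]
  have hab : Function.Bijective (Sum.elim (fun s => (f s).1) (fun s => K.s (q s))) := by
    constructor
    · rintro (s | s) (s' | s') h
      · exact congrArg _ (f.injective (Subtype.ext h))
      · exact (K.bd_sub (f s).2 ⟨_, h.symm⟩).elim
      · exact (K.bd_sub (f s').2 ⟨_, h⟩).elim
      · exact congrArg _ (hqb.1 (K.s_inj h))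
    · intro a
      rcases conn.mem_bd_or u a with h | ⟨d, rfl⟩
      · exact ⟨Sum.inl (f.symm ⟨a, h⟩), congrArg Subtype.val (f.apply_symm_apply ⟨a, h⟩)⟩
      · obtain ⟨s, rfl⟩ := hqb.2 d
        exact ⟨Sum.inr s, rfl⟩
  let w : MGraph.Iso (MGraph.star S.S) K :=
    { a := Equiv.ofBijective _ hab
      d := Equiv.ofBijective q hqb
      v := ⟨fun _ => u, fun _ => (), fun _ => rfl, fun _ => (hu _).symm⟩
      a_i := by
        rintro (s | s)
        · exact hq s
        · exact (hq' s).symm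
      a_s := fun _ => rfl
      v_t := fun _ => (hu _).symm
      a_bd := by
        rintro (s | s)
        · exact iff_of_true (f s).2 ⟨s, rfl⟩
        · refine iff_of_false (not_bd_s _) ?_
          rintro ⟨_, h⟩
          cases h }
  let z : CGr.Iso (CGr.star S) ⟨K, conn, ζ, ζ_i, f, ζ_f⟩ :=
    { w with
      ζ := by
        rintro (s | s)
        · exact ζ_f s
        · change ζ (K.s (q s)) = C.inv (S.ξ s)
          rw [hq, ζ_i, ζ_f]
      f := fun _ => rfl }
  let k : S ⟶ CGr.nb ⟨K, conn, ζ, ζ_i, f, ζ_f⟩ u := CGr.starHom S ≫ z.nbHom ()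
  refine ⟨⟨k.e.symm, fun n => ?_⟩, T.mk_eq.2 (Dec.Rel.symm ⟨z, fun _ => ?_⟩)⟩
  · rw [← k.comm, Equiv.apply_symm_apply]
  · refine (X.map_comp_apply (CGr.starHom S) (z.nbHom ()) _).symm.trans ?_
    exact Bij.map_map_id X _ k (fun n => k.e.apply_symm_apply n) _

/-- The star of a vertex `w` of the target represents the generator `w`. -/
theorem mk_embDec_starEmb {G G' : MGraph} (φ : GMap G G') (v : G.V) (w : G'.V)
    (hw : Emb.mk (starEmb G' w) = φ.one v)
    (x : (gens G').obj ((Bij.recolor φ.colors).obj (outArcs G v))) (hx : x.down.1 = w) :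
    T.mk (embDec φ v (starEmb G' w) hw) = T.mk (Dec.star x) := by
  obtain ⟨l, hl⟩ := Dec.mk_eq_star (embDec φ v (starEmb G' w) hw) () (fun _ => rfl)
    (fun d => ⟨d, rfl⟩)
  rw [hl]
  exact congrArg (fun x => T.mk (Dec.star x)) (gens_ext hx.symm)

/-! ### Functoriality -/

theorem JMap_id (G : U) : JMap (𝟙 G) = 𝟙 (JObj G) :=
  CSM.Hom.ext_gen rfl fun v => heq_of_eq <|
    (JMap_onGen (𝟙 G) v (starEmb G.graph v) rfl).trans
      (mk_embDec_starEmb (idMap G) v v rfl (gen G.graph v) rfl)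

theorem JMap_comp (G G' G'' : U) (φ : G ⟶ G') (ψ : G' ⟶ G'') :
    JMap (φ ≫ ψ) = JMap φ ≫ JMap ψ := by
  refine CSM.Hom.ext_gen rfl fun v => heq_of_eq ?_
  let r := Emb.rep (GMap.one φ v)
  have hr : Emb.mk r = GMap.one φ v := Emb.mk_rep _
  let R : r.dom.V → BigEmb G''.graph := fun w => Emb.rep (GMap.one ψ (r.map.v w))
  have hR : ∀ w, Emb.mk (R w) = GMap.one ψ (r.map.v w) := fun w => Emb.mk_rep _
  have hc : Emb.mk (compEmb r ψ R hR) = GMap.one (φ ≫ ψ) v :=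
    (compMap_one φ ψ v r hr R hR).symm
  let l : ∀ w, outArcs G'.graph (r.map.v w) ⟶ (embDec φ v r hr).gr.nb w := fun w =>
    ⟨(r.map.nb w).symm, fun n => by
      obtain ⟨n, rfl⟩ := (r.map.nb w).surjective n
      refine (congrArg ((embDec φ v r hr).gr.nb w).ξ
        ((r.map.nb w).symm_apply_apply n)).trans (congrArg ULift.up ?_)
      change r.map.a (r.dom.i (r.dom.s n.1)) = G'.graph.i (G'.graph.s (r.map.d n.1))
      rw [r.map.a_i, r.map.a_s]⟩
  let y : ∀ w, Dec (gens G''.graph)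
      ((Bij.recolor (GMap.colors ψ)).obj ((embDec φ v r hr).gr.nb w)) := fun w =>
    (embDec ψ (r.map.v w) (R w) (hR w)).push ((Bij.recolor (GMap.colors ψ)).map (l w))
  have hy : ∀ w, T.mk (y w) = CSM.Hom.onGen (JMap ψ) ((embDec φ v r hr).el w) := fun w => by
    have h1 : (embDec φ v r hr).el w = (gens G'.graph).map (l w) (gen G'.graph (r.map.v w)) :=
      gens_ext rfl
    refine Eq.trans ?_ ((congrArg (CSM.Hom.onGen (JMap ψ)) h1).trans
      (CSM.Hom.onGen_map (JMap ψ) (l w) _)).symm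
    exact congrArg ((TObj (gens G''.graph)).map ((Bij.recolor (GMap.colors ψ)).map (l w)))
      (JMap_onGen ψ _ (R w) (hR w)).symm
  refine (JMap_onGen (φ ≫ ψ) v _ hc).trans ?_
  refine Eq.trans ?_ ((CSM.Hom.app_mk_subst (JMap ψ) (embDec φ v r hr) y hy).symm.trans
    (congrArg ((JMap ψ).fib.f.app _) (JMap_onGen φ v r hr).symm))
  refine T.mk_eq.2 ⟨⟨MGraph.Iso.refl _, ?_, fun n => ?_⟩, fun w => ?_⟩
  · exact Filling.arc_ind _ (fun _ => rfl) (fun _ _ => rfl)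
  -- Both boundary arcs are sent to `ψ (φ (i (s n)))`, and embeddings are injective on boundaries.
  · refine (compEmb r ψ R hR).injOn_bd (Subtype.property _)
      ⟨_, (φ.bdEquiv v r hr n).2, rfl⟩ ?_
    refine (GMap.bdEquiv_spec (φ ≫ ψ) v _ hc n).trans ?_
    exact congrArg (GMap.zero ψ) (φ.bdEquiv_spec v r hr n).symm
  · exact gens_ext rfl

/-! ### Faithfulness -/

theorem JMap_injective {G G' : U} {φ ψ : G ⟶ G'} (h : JMap φ = JMap ψ) : φ = ψ := by
  have h0 : GMap.zero φ = GMap.zero ψ := funext fun a =>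
    ULift.up_injective (congrFun (congrArg (fun F : CSM.Hom (JObj G) (JObj G') => F.base.toFun) h)
      (ULift.up a))
  have hg : ∀ v, HEq (CSM.Hom.onGen (JMap φ) (gen G.graph v))
      (CSM.Hom.onGen (JMap ψ) (gen G.graph v)) := fun v => by rw [h]
  obtain ⟨φ₀, φ₁, hφi, hφn, hφb, hφc⟩ := φ
  obtain ⟨ψ₀, ψ₁, hψi, hψn, hψb, hψc⟩ := ψ
  obtain rfl : φ₀ = ψ₀ := h0
  refine GMap.ext rfl (funext fun v => ?_)
  obtain ⟨r, hr⟩ := Emb.exists_rep (φ₁ v)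
  obtain ⟨r', hr'⟩ := Emb.exists_rep (ψ₁ v)
  have h1 := eq_of_heq (hg v)
  obtain ⟨z, hz⟩ := T.mk_eq.1 (((JMap_onGen (G := G) (G' := G') _ v r hr).symm.trans h1).trans
    (JMap_onGen (G := G) (G' := G') _ v r' hr'))
  refine hr.symm.trans (Eq.trans (Emb.mk_eq.2 ?_) hr')
  exact BigEmb.rel_of z.toIso (fun x => ULift.up_injective (z.ζ x).symm)
    (fun w => congrArg (fun x => x.down.1) (hz w))

/-! ### Isomorphisms of operads generated by graphs -/

/-- The identity sends a generator to a star. This is stated for a morphism merely equal to the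
identity because a composite of two morphisms changes colours along the composite of their maps of
colours. -/
theorem iso_star_of_eq_id {G : U} {H : JObj G ⟶ JObj G} (hH : H = 𝟙 _) {S : Bij (arcs G.graph)}
    (x : (gens G.graph).obj S) (q : Dec (gens G.graph) ((Bij.recolor (CSM.Hom.base H)).obj S))
    (hq : T.mk q = CSM.Hom.onGen H x) : Nonempty (MGraph.Iso q.gr.G (MGraph.star S.S)) := by
  subst hH
  obtain ⟨z, _⟩ := T.mk_eq.1 (hq.trans (rfl : _ = T.mk (Dec.star x)))
  exact ⟨z.toIso⟩

section Inverse

variable {G G' : U} {F : JObj G ⟶ JObj G'} {F' : JObj G' ⟶ JObj G}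

/-- If `F` sends a generator to the class of a decorated graph `p`, then substituting into the
vertices of `p` the graphs assigned to them by a left inverse of `F` gives back a star. -/
theorem exists_subst_iso_star (hF : F ≫ F' = 𝟙 _) {S : Bij (arcs G.graph)}
    (x : (gens G.graph).obj S) (p : Dec (gens G'.graph) ((Bij.recolor (CSM.Hom.base F)).obj S))
    (hp : T.mk p = CSM.Hom.onGen F x) :
    ∃ y : ∀ v, Dec (gens G.graph) ((Bij.recolor (CSM.Hom.base F')).obj (p.gr.nb v)),
      (∀ v, T.mk (y v) = CSM.Hom.onGen F' (p.el v)) ∧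
      Nonempty (MGraph.Iso
        ((p.gr.recolor (CSM.Hom.base F')).fill fun v => (y v).gr).subst (MGraph.star S.S)) := by
  let y : ∀ v, Dec (gens G.graph) ((Bij.recolor (CSM.Hom.base F')).obj (p.gr.nb v)) :=
    fun v => T.rep (CSM.Hom.onGen F' (p.el v))
  have hy : ∀ v, T.mk (y v) = CSM.Hom.onGen F' (p.el v) := fun v => T.mk_rep _
  refine ⟨y, hy, iso_star_of_eq_id hF x
    (Dec.subst (S := (Bij.recolor (CSM.Hom.base F')).obj ((Bij.recolor (CSM.Hom.base F)).obj S))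
      (p.gr.recolor (CSM.Hom.base F')) y) ?_⟩
  exact (CSM.Hom.app_mk_subst F' p y hy).symm.trans (congrArg ((CSM.Hom.fib F').f.app _) hp)

/-- A substitution into a graph without vertices has no vertices, so a morphism with a left inverse
sends a generator to a graph with a vertex. -/
theorem nonempty_vertex (hF : F ≫ F' = 𝟙 _) {S : Bij (arcs G.graph)}
    (x : (gens G.graph).obj S) (p : Dec (gens G'.graph) ((Bij.recolor (CSM.Hom.base F)).obj S))
    (hp : T.mk p = CSM.Hom.onGen F x) : Nonempty p.gr.G.V := by
  obtain ⟨y, _, ⟨z⟩⟩ := exists_subst_iso_star hF x p hp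
  exact ⟨(z.v.symm ()).1⟩

/-- An isomorphism sends generators to generators. -/
theorem exists_onGen_eq_star (hF : F ≫ F' = 𝟙 _) (hF' : F' ≫ F = 𝟙 _) {S : Bij (arcs G.graph)}
    (x : (gens G.graph).obj S) :
    ∃ x' : (gens G'.graph).obj ((Bij.recolor (CSM.Hom.base F)).obj S),
      CSM.Hom.onGen F x = T.mk (Dec.star x') := by
  obtain ⟨p, hp⟩ : ∃ p : Dec (gens G'.graph) ((Bij.recolor (CSM.Hom.base F)).obj S),
      T.mk p = CSM.Hom.onGen F x := ⟨_, T.mk_rep _⟩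
  obtain ⟨y, hy, ⟨z⟩⟩ := exists_subst_iso_star hF x p hp
  have hne : ∀ v, Nonempty (y v).gr.G.V := fun v => nonempty_vertex hF' (p.el v) (y v) (hy v)
  obtain ⟨u⟩ := nonempty_vertex hF x p hp
  -- The vertices of the substitution are the vertices of all the `y v`, and there is only one.
  have hu : ∀ u', u' = u := fun u' => by
    obtain ⟨w'⟩ := hne u'
    obtain ⟨w⟩ := hne u
    have h : (⟨u', w'⟩ : Σ v, (y v).gr.G.V) = ⟨u, w⟩ := z.v.injective rfl
    exact congrArg Sigma.fst h
  obtain ⟨w⟩ := hne u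
  -- Were there a loop at `u`, then `y u` would have more incoming arcs than the star.
  have hcard : Nat.card p.gr.G.D ≤ Nat.card p.gr.G.bd := by
    have h1 : Nat.card p.gr.G.D = Nat.card (y u).gr.G.bd := by
      rw [← Nat.card_congr (y u).gr.f]
      exact (Nat.card_congr (Equiv.subtypeUnivEquiv fun d => hu _)).symm
    have h2 : Nat.card (y u).gr.G.bd ≤ Nat.card (y u).gr.G.D := by
      choose q hq using fun b : (y u).gr.G.bd => (y u).gr.conn.i_mem_range_s w b.2
      refine Nat.card_le_card_of_injective q fun b b' h => Subtype.ext ((y u).gr.G.i_inj ?_)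
      rw [← hq, ← hq, h]
    have h3 : Nat.card (y u).gr.G.D ≤ Nat.card (Σ v, (y v).gr.G.D) :=
      haveI : Finite p.gr.G.V := p.gr.G.finV
      Nat.card_le_card_of_injective (fun d => (⟨u, d⟩ : Σ v, (y v).gr.G.D)) 
        fun d d' h => eq_of_heq (Sigma.mk.inj_iff.1 h).2
    have h4 : Nat.card (Σ v, (y v).gr.G.D) = Nat.card S.S := Nat.card_congr z.d
    have h5 : Nat.card S.S = Nat.card p.gr.G.bd := Nat.card_congr p.gr.f
    omega
  have hbd : ∀ d, p.gr.G.i (p.gr.G.s d) ∈ p.gr.G.bd := by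
    choose q hq using fun b : p.gr.G.bd => p.gr.conn.i_mem_range_s u b.2
    have hqi : Function.Injective q := fun b b' h => Subtype.ext (p.gr.G.i_inj (by
      rw [← hq, ← hq, h]))
    intro d
    obtain ⟨b, rfl⟩ := (hqi.bijective_of_nat_card_le hcard).2 d
    rw [hq, p.gr.G.i_i]
    exact b.2
  obtain ⟨l, hl⟩ := p.mk_eq_star u hu hbd
  exact ⟨_, hp.symm.trans hl⟩

/-- Every isomorphism comes from a graphical map, which sends each vertex to the star of a vertex. -/
theorem exists_JMap_eq (hF : F ≫ F' = 𝟙 _) (hF' : F' ≫ F = 𝟙 _) : ∃ φ : G ⟶ G', JMap φ = F := by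
  choose x hx using fun v => exists_onGen_eq_star hF hF' (gen G.graph v)
  let f₀ : G.graph.A → G'.graph.A := fun a => ((CSM.Hom.base F).toFun (ULift.up a)).down
  have hinj : Function.Injective f₀ := fun a b h => by
    have h1 : ∀ c, (CSM.Hom.base F').toFun ((CSM.Hom.base F).toFun c) = c := fun c =>
      congrFun (congrArg (fun H : CSM.Hom (JObj G) (JObj G) => H.base.toFun) hF) c
    exact ULift.up_injective (((h1 _).symm.trans (congrArg _ (ULift.down_injective h))).trans
      (h1 _))
  -- The description of the generator `x v`: the arcs pointing away from `v` go to those of its vertex.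
  have hbij : ∀ v, Set.BijOn (fun d => f₀ (G.graph.i (G.graph.s d))) {d | G.graph.t d = v}
      (Emb.mk (starEmb G'.graph (x v).down.1)).bdry := fun v => by
    rw [Emb.bdry_mk, starEmb_bdry]
    have hr := (x v).down.2.2
    refine ⟨fun d hd => ?_, fun d _ d' _ h => G.graph.s_inj (G.graph.i_inj (hinj h)), ?_⟩
    · obtain ⟨d', h1, h2⟩ := hr.subset ⟨⟨d, hd⟩, rfl⟩
      exact ⟨d', h1, h2.symm⟩
    · rintro _ ⟨d', hd', rfl⟩
      obtain ⟨n, hn⟩ := hr.superset ⟨d', hd', (rfl : (ULift.up _ : ULift.{1} G'.graph.A).down = _)⟩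
      exact ⟨n.1, n.2, congrArg ULift.down hn⟩
  have hvinj : ∀ v v', (x v).down.1 = (x v').down.1 → v = v' := fun v v' h => by
    have key : ∀ u u', (x u).down.1 = (x u').down.1 → ∀ d, G.graph.t d = u → G.graph.t d = u' :=
      fun u u' huu d hd => by
        have h1 := (hbij u).1 hd
        rw [huu] at h1
        obtain ⟨d', h2, h3⟩ := (hbij u').2.2 h1
        have h4 : d' = d := G.graph.s_inj (G.graph.i_inj (hinj h3))
        exact h4 ▸ h2
    exact G.conn.vertex_ext fun d => ⟨key v v' h d, key v' v h.symm d⟩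
  let φ : GMap G.graph G'.graph :=
    { zero := f₀
      one := fun v => Emb.mk (starEmb G'.graph (x v).down.1)
      zero_i := fun a => congrArg ULift.down ((CSM.Hom.base F).map_inv (ULift.up a))
      noDouble := (noDouble_iff _).2 fun v v' _ _ h => hvinj v v' h
      boundary := hbij
      collapse := fun h => by
        obtain ⟨v⟩ := G.exists_vertex h
        exact ⟨v, fun h' => ((U.isEdge_iff _).1 h').false ()⟩ }
  refine ⟨φ, CSM.Hom.ext_gen rfl fun v => heq_of_eq ?_⟩
  exact (JMap_onGen (G := G) (G' := G') φ v _ rfl).trans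
    ((mk_embDec_starEmb φ v _ rfl (x v) rfl).trans (hx v).symm)

/-- Both `f` and its inverse come from graphical maps, which are mutually inverse by faithfulness. -/
theorem exists_iso (f : JObj G ≅ JObj G') : ∃ φ : G ≅ G', JMap φ.hom = f.hom := by
  obtain ⟨φ, hφ⟩ := exists_JMap_eq f.hom_inv_id f.inv_hom_id
  obtain ⟨ψ, hψ⟩ := exists_JMap_eq f.inv_hom_id f.hom_inv_id
  refine ⟨⟨φ, ψ, JMap_injective ?_, JMap_injective ?_⟩, hφ⟩
  · rw [JMap_comp, hφ, hψ, f.hom_inv_id, JMap_id]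
  · rw [JMap_comp, hφ, hψ, f.inv_hom_id, JMap_id]

end Inverse

end ModOp

theorem mainTheorem3 :
    ∃ (h_id : ∀ G : ModOp.U, ModOp.JMap (𝟙 G) = 𝟙 (ModOp.JObj G))
      (h_comp : ∀ (G G' G'' : ModOp.U) (φ : G ⟶ G') (ψ : G' ⟶ G''),
        ModOp.JMap (φ ≫ ψ) = ModOp.JMap φ ≫ ModOp.JMap ψ),
      (ModOp.J h_id h_comp).Faithful ∧
      (∀ G G' : ModOp.U,
        Nonempty ((ModOp.J h_id h_comp).obj G ≅ (ModOp.J h_id h_comp).obj G') →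
          Nonempty (G ≅ G')) ∧
      (∀ (G G' : ModOp.U) (f : (ModOp.J h_id h_comp).obj G ≅ (ModOp.J h_id h_comp).obj G'),
        ∃ φ : G ≅ G', (ModOp.J h_id h_comp).mapIso φ = f) :=
  ⟨ModOp.JMap_id, ModOp.JMap_comp, ⟨fun h => ModOp.JMap_injective h⟩,
    fun _ _ ⟨f⟩ => ⟨(ModOp.exists_iso f).choose⟩,
    fun _ _ f => (ModOp.exists_iso f).imp fun _ h => Iso.ext h⟩
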